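/- **Model.** An input is a stream $\sigma$ of tokens $(u,v,\Delta)\in[n]\times[n]\times\mathbb Z$, each adding $\Delta$ to the multiplicity of the directed edge $(u,v)$; it describes the digraph $G$ on $[n]$ whose edges are the pairs with positive final multiplicity. In a *scheme*, Verifier draws random coins $R$ uniformly from a finite set, reads $\sigma$ token by token, and then reads a help message (a bit string, chosen by Prover, who knows $\sigma$ but not $R$) bit by bit; his memory has $v$ bits, i.e. at most $2^v$ memory states. While reading the help message he may write on a write-only output stream; at the end he either accepts, so that the written sequence is his output, or rejects (output $\bot$). The scheme is an $(h,v)$-scheme for a problem, with completeness error $\varepsilon_c$ and soundness error $\varepsilon_s$, if for every admissible $\sigma$ (i) some help message of at most $h$ bits makes the output correct with probability at least $1-\varepsilon_c$, and (ii) for every help message, the probability that the output is neither correct nor $\bot$ is at most $\varepsilon_s$. In **TopoSort**, $G$ is promised to be a DAG and the correct outputs are the orderings of $[n]$ that orient all edges of $G$ forwards. In **Acyclicity**, the correct output is the bit telling whether $G$ has no directed cycle (a loop is a cycle). **Theorem.** (a) Fix $K\in\mathbb N$ and consider all turnstile streams whose final multiplicities lie between $0$ and $n^K$. There are constants $C,k$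 such that for all integers $n\ge 1$ and $t,s\geq 1$ with $ts\ge n$ (in particular for $ts=n$), each of TopoSort and Acyclicity has an $(h,v)$-scheme with $h\le C\,nt\,(\log_2 n+1)^k$, $v\le C\,s\,(\log_2 n+1)^k$, completeness error $0$ and soundness error at most $1/3$ (that is, an $[nt,s]$-scheme); moreover, the coins $R$ can be described by at most $C\,s\,(\log_2 n+1)^k$ bits. (b) This is optimal up to logarithmic factors: there are $c>0$ and $n_0$ such that for all $n\ge n_0$, $h\ge 1$ and $v\geq 0$, every $(h,v)$-scheme for TopoSort, and every $(h,v)$-scheme for Acyclicity, with completeness and soundness errors at most $1/3$ satisfies $hv\ge c\,n^2$. This holds even if the scheme only has to work on insertion-only streams that list the edges of a simple loopless digraph once each, and even if random coins are not counted as memory. -/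

import Mathlib

/-- A token `(u, v, Δ)` of a turnstile stream on the vertex set `Fin n`: add `Δ` to the
multiplicity of the directed edge from `u` to `v`. -/
structure EdgeUpdate (n : ℕ) where
  src : Fin n
  dst : Fin n
  delta : ℤ

/-- A stream of edge updates. -/
abbrev EdgeStream (n : ℕ) : Type := List (EdgeUpdate n)

namespace EdgeStream

variable {n : ℕ}

/-- The multiplicity of the directed edge `(u, v)` after the whole stream. -/
def multiplicity (σ : EdgeStream n) (u v : Fin n) : ℤ :=
  (σ.map fun τ => if τ.src = u ∧ τ.dst = v then τ.delta else 0).sum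

/-- `(u, v)` is an edge of the digraph described by the stream. -/
def Edge (σ : EdgeStream n) (u v : Fin n) : Prop := 0 < multiplicity σ u v

/-- The digraph described by the stream has no directed cycle (a loop is a cycle). -/
def IsAcyclic (σ : EdgeStream n) : Prop := ∀ v, ¬ Relation.TransGen (Edge σ) v v

/-- The list `l` contains every vertex exactly once and orients all edges forwards. -/
def IsTopologicalOrder (σ : EdgeStream n) (l : List (Fin n)) : Prop :=
  l.Nodup ∧ (∀ v, v ∈ l) ∧ ∀ u v, Edge σ u v → l.idxOf u < l.idxOf v

/-- Turnstile streams (insertions and deletions) whose final multiplicities all lie between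
`0` and `n ^ K`. -/
def turnstile (n K : ℕ) : Set (EdgeStream n) :=
  {σ | ∀ u v, 0 ≤ multiplicity σ u v ∧ multiplicity σ u v ≤ (n : ℤ) ^ K}

/-- Insertion-only streams that list the edges of a simple loopless digraph, each exactly once. -/
def simpleVanilla (n : ℕ) : Set (EdgeStream n) :=
  {σ | List.Nodup σ ∧ ∀ τ ∈ σ, τ.delta = 1 ∧ τ.src ≠ τ.dst}

end EdgeStream

/-- A problem about edge streams: the streams that may be given as inputs, and, for each of them,
the correct answers. An answer is a finite sequence of symbols from `Γ`. -/
structure StreamProblem (n : ℕ) (Γ : Type) where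
  inputs : Set (EdgeStream n)
  IsAnswer : EdgeStream n → List Γ → Prop

/-- Topological sorting: the input (from the class `A` of streams) describes a DAG, and the answer
is any topological order of it. -/
def topoSort (n : ℕ) (A : Set (EdgeStream n)) : StreamProblem n (Fin n) where
  inputs := {σ | σ ∈ A ∧ EdgeStream.IsAcyclic σ}
  IsAnswer := EdgeStream.IsTopologicalOrder

/-- Acyclicity testing: the answer is the single bit telling whether the input digraph is
acyclic. -/
def acyclicity (n : ℕ) (A : Set (EdgeStream n)) : StreamProblem n Bool where
  inputs := A
  IsAnswer σ y := (y = [true] ∧ EdgeStream.IsAcyclic σ) ∨ (y = [false] ∧ ¬ EdgeStream.IsAcyclic σ)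

/-- The Verifier of a scheme for edge streams on `n` vertices. He draws `r` uniformly from `Coins`.
His memory always holds an element of `State`. He first reads the input stream token by token and
then the help message (proof stream) bit by bit. While reading the help message he may append
symbols to a write-only output stream. At the end he either rejects (`none`, that is `⊥`) or
accepts, possibly after writing some last symbols. -/
structure Scheme (n : ℕ) (Γ : Type) where
  Coins : Type
  [coinsFintype : Fintype Coins]
  [coinsNonempty : Nonempty Coins]
  State : Type
  [stateFintype : Fintype State]
  init : Coins → State
  readToken : Coins → State → EdgeUpdate n → State
  readHelp : Coins → State → Bool → State
  write : Coins → State → Bool → List Γ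
  finish : Coins → State → Option (List Γ)

namespace Scheme

attribute [instance] Scheme.coinsFintype Scheme.coinsNonempty Scheme.stateFintype

variable {n : ℕ} {Γ : Type}

/-- The memory content after the input stream. -/
def summary (S : Scheme n Γ) (r : S.Coins) (σ : EdgeStream n) : S.State :=
  List.foldl (S.readToken r) (S.init r) σ

/-- Verifier's output when he reads the help message starting from memory content `q`. -/
def outFrom (S : Scheme n Γ) (r : S.Coins) : S.State → List Bool → Option (List Γ)
  | q, [] => S.finish r q
  | q, b :: H => (S.outFrom r (S.readHelp r q b) H).map fun y => S.write r q b ++ y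

/-- Verifier's output on input stream `σ` and help message `H`; `none` means "reject". -/
def out (S : Scheme n Γ) (r : S.Coins) (σ : EdgeStream n) (H : List Bool) : Option (List Γ) :=
  S.outFrom r (S.summary r σ) H

open scoped Classical in
/-- The probability of an event over the uniformly random coins. -/
noncomputable def prob (S : Scheme n Γ) (E : S.Coins → Prop) : ℝ :=
  ((Finset.univ.filter E).card : ℝ) / (Fintype.card S.Coins : ℝ)

/-- Verifier's memory has at most `v` bits. -/
def SpaceAtMost (S : Scheme n Γ) (v : ℕ) : Prop := Fintype.card S.State ≤ 2 ^ v

/-- Verifier's random choice can be described by at most `v` bits. -/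
def RandomnessAtMost (S : Scheme n Γ) (v : ℕ) : Prop := Fintype.card S.Coins ≤ 2 ^ v

/-- The scheme solves the problem `P` with help messages of at most `h` bits, completeness error
`εc` and soundness error `εs`. The Prover sees the input stream, but not the coins. -/
def Solves (S : Scheme n Γ) (P : StreamProblem n Γ) (h : ℕ) (εc εs : ℝ) : Prop :=
  (∀ σ ∈ P.inputs, ∃ H : List Bool, H.length ≤ h ∧
    1 - εc ≤ S.prob fun r => ∃ y, S.out r σ H = some y ∧ P.IsAnswer σ y) ∧
  (∀ σ ∈ P.inputs, ∀ H : List Bool,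
    S.prob (fun r => ∃ y, S.out r σ H = some y ∧ ¬ P.IsAnswer σ y) ≤ εs)

end Scheme

/-- For all parameters `t`, `s` with `t * s ≥ n` (in particular for `t * s = n`), the family of
problems `P` has an `[n t, s]`-scheme: help of `Õ(n t)` bits, memory (also with the random bits
counted) of `Õ(s)` bits, perfect completeness, and soundness error at most `1/3`. Here `Õ` hides
a constant factor and a fixed power of `log n`, both independent of `n`, `t`, `s`. -/
def HasNTSSchemes {Γ : ℕ → Type} (P : ∀ n, StreamProblem n (Γ n)) : Prop :=
  ∃ C k : ℕ, ∀ n t s : ℕ, 0 < n → n ≤ t * s →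
    ∃ S : Scheme n (Γ n),
      S.SpaceAtMost (C * s * (Nat.log 2 n + 1) ^ k) ∧
      S.RandomnessAtMost (C * s * (Nat.log 2 n + 1) ^ k) ∧
      S.Solves (P n) (C * (n * t) * (Nat.log 2 n + 1) ^ k) 0 (1 / 3)

/-- Every `(h, v)`-scheme (even with completeness error `1/3`, and with free random bits) for the
family of problems `P` has `h * v = Ω(n ^ 2)`. A scheme without help is a scheme with `h = 1`. -/
def RequiresQuadraticProduct {Γ : ℕ → Type} (P : ∀ n, StreamProblem n (Γ n)) : Prop :=
  ∃ c : ℝ, 0 < c ∧ ∃ n₀ : ℕ, ∀ n ≥ n₀, ∀ h v : ℕ, 1 ≤ h →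
    ∀ S : Scheme n (Γ n), S.SpaceAtMost v → S.Solves (P n) h (1 / 3) (1 / 3) →
      c * (n : ℝ) ^ 2 ≤ (h : ℝ) * (v : ℝ)

/-! Upper bound. Work over a prime field of size polynomial in n and index each vertex by a class in
[s] and a column in [t]. A matrix on pairs of vertices becomes, for each class b, a function of two
variables of degree below n and below t that interpolates its entries in that class. While reading
the stream, Verifier keeps only the s values A_b(r) of the multiplicity matrix A at one secret
random point r; they are linear in the stream. For a second matrix B, the function Σ_b A_b B_b has
degrees below 2n and 2t, and its sum over the column nodes at row node u is Σ_v A(u,v) B(u,v)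
(`Frame.sum_pairing_node`).

For an announced order let B(u,v) say that v does not come after u. The order is topological iff all
these row sums vanish. Verifier can evaluate B at r while the order is announced. Prover describes
Σ_b A_b B_b by coefficients in a basis of the space of functions whose row sums vanish
(`Frame.vanishing`), which has dimension at most 4nt, so only an equality at r remains to be tested.
For a cyclic digraph Prover announces a set of vertices without a sink and gives each of them the
inverse of its out-degree into the set, with multiplicity. The weighted row sums are then 1 on the
set, which is impossible at a sink. Since the message does not depend on r, a false identity passes
for few r (`card_zeros₂_le`).

Lower bound. Both problems encode the index problem on ⌊n/4⌋² bits (`IndexGadget`). A scheme is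
repeated Θ(h) times, and the receiver tries all help messages of at most h bits. This gives a
one-way protocol with O(hv) bits of communication (`Scheme.card_le_of_index_reduction`), whereas the
index problem needs linearly many (`four_pow_card_le_of_index_protocol`). -/

/-! ### Lower bound: amplification and the index problem -/

open Finset in
theorem card_filter_half_le {α : Type*} [Fintype α] (E : α → Prop) [DecidablePred E] (j : ℕ)
    (hE : (#{a | E a} : ℝ) ≤ 1 / 3 * Fintype.card α) :
    (#{r : Fin (2 * j) → α | j ≤ #{l | E (r l)}} : ℝ) ≤
      (8 / 9) ^ j * (Fintype.card α : ℝ) ^ (2 * j) := by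
  -- Exponential moment: a coin in `E` weighs 2, so the mean weight of one coin is at most 4/3, and
  -- (4/3)² / 2 = 8/9.
  have key : (2 : ℝ) ^ j * (#{r : Fin (2 * j) → α | j ≤ #{l | E (r l)}} : ℝ) ≤
      (4 / 3 * (Fintype.card α : ℝ)) ^ (2 * j) := by
    calc (2 : ℝ) ^ j * (#{r : Fin (2 * j) → α | j ≤ #{l | E (r l)}} : ℝ)
        = ∑ r : Fin (2 * j) → α with j ≤ #{l | E (r l)}, (2 : ℝ) ^ j := by
          rw [sum_const, nsmul_eq_mul, mul_comm]
      _ ≤ ∑ r : Fin (2 * j) → α with j ≤ #{l | E (r l)}, ∏ l, (if E (r l) then (2 : ℝ) else 1) := by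
          refine sum_le_sum fun r hr => ?_
          rw [prod_ite, prod_const, prod_const_one, mul_one]
          exact pow_le_pow_right₀ one_le_two (mem_filter.1 hr).2
      _ ≤ ∑ r : Fin (2 * j) → α, ∏ l, (if E (r l) then (2 : ℝ) else 1) :=
          sum_le_sum_of_subset_of_nonneg (filter_subset _ _) fun r _ _ =>
            prod_nonneg fun l _ => by split_ifs <;> norm_num
      _ = (∑ a : α, if E a then (2 : ℝ) else 1) ^ (2 * j) := by
          rw [Fintype.sum_pow]
      _ ≤ (4 / 3 * (Fintype.card α : ℝ)) ^ (2 * j) := by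
          have h2 : (∑ a : α, if E a then (2 : ℝ) else 1) = Fintype.card α + #{a | E a} := by
            have : ∀ a, (if E a then (2 : ℝ) else 1) = 1 + if E a then 1 else 0 := by
              intro a; split_ifs <;> norm_num
            simp_rw [this, sum_add_distrib]
            simp
          refine pow_le_pow_left₀ (by rw [h2]; positivity) ?_ _
          rw [h2]; linarith
  have h3 : (4 / 3 * (Fintype.card α : ℝ)) ^ (2 * j) =
      2 ^ j * ((8 / 9) ^ j * (Fintype.card α : ℝ) ^ (2 * j)) := by
    rw [mul_pow, pow_mul (4 / 3 : ℝ), ← mul_assoc, ← mul_pow]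
    norm_num
  rw [h3] at key
  exact le_of_mul_le_mul_left key (by positivity)

open Finset in
/-- A one-way protocol with shared randomness for the index problem with error `1/8` needs
messages of linear length. -/
theorem four_pow_card_le_of_index_protocol {I R M : Type} [Fintype I] [DecidableEq I] [Fintype R]
    [Nonempty R] [Fintype M] (msg : R → (I → Bool) → M) (guess : R → M → I → Bool)
    (herr : ∀ x i, (#{r | guess r (msg r x) i ≠ x i} : ℝ) ≤ 1 / 8 * Fintype.card R) :
    4 ^ Fintype.card I ≤ Fintype.card M ^ 8 := by
  set N := Fintype.card I
  let d : R → (I → Bool) → ℕ := fun r x => #{i | guess r (msg r x) i ≠ x i}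
  let T : ℝ := Fintype.card R * 2 ^ N
  have hR : (0 : ℝ) < Fintype.card R := by exact_mod_cast Fintype.card_pos
  have hT : 0 < T := by positivity
  have hcardX : (Fintype.card (I → Bool) : ℝ) = 2 ^ N := by simp [N]
  have hsum : ∑ r, ∑ x, (d r x : ℝ) ≤ T * (N / 8) := by
    have : ∑ r, ∑ x, (d r x : ℝ) = ∑ x, ∑ i, (#{r | guess r (msg r x) i ≠ x i} : ℝ) := by
      rw [sum_comm]
      refine sum_congr rfl fun x _ => ?_
      simp only [d, card_filter, Nat.cast_sum]
      rw [sum_comm]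
    rw [this]
    calc ∑ x, ∑ i, (#{r | guess r (msg r x) i ≠ x i} : ℝ)
        ≤ ∑ x : I → Bool, ∑ i : I, (1 / 8 * Fintype.card R : ℝ) :=
          sum_le_sum fun x _ => sum_le_sum fun i _ => herr x i
      _ = T * (N / 8) := by
          simp only [sum_const, card_univ, nsmul_eq_mul, hcardX]
          simp only [T, N]; ring
  -- Jensen's inequality for d ↦ 2⁻ᵈ, by the tangent line at d = N/8. Its slope is negative, so the
  -- upper bound on the total error suffices.
  have hlow : T * Real.exp (-(Real.log 2 * (N / 8))) ≤ ∑ r, ∑ x, (1 / 2 : ℝ) ^ d r x := by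
    have hpt : ∀ r x, Real.exp (-(Real.log 2 * (N / 8))) *
        (1 - Real.log 2 * (d r x - N / 8)) ≤ (1 / 2 : ℝ) ^ d r x := by
      intro r x
      have h1 : (1 / 2 : ℝ) ^ d r x = Real.exp (-(Real.log 2 * (N / 8))) *
          Real.exp (-(Real.log 2 * (d r x - N / 8))) := by
        rw [← Real.exp_add, one_div, inv_pow, ← Real.rpow_natCast,
          Real.rpow_def_of_pos two_pos, ← Real.exp_neg]
        congr 1; ring
      rw [h1]
      refine mul_le_mul_of_nonneg_left ?_ (Real.exp_pos _).le
      linarith [Real.add_one_le_exp (-(Real.log 2 * (d r x - N / 8)))]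
    refine le_trans ?_ (sum_le_sum fun r _ => sum_le_sum fun x _ => hpt r x)
    simp_rw [← mul_sum]
    rw [mul_comm T]
    refine mul_le_mul_of_nonneg_left ?_ (Real.exp_pos _).le
    simp_rw [sum_sub_distrib, ← mul_sum, sum_sub_distrib]
    simp only [sum_const, card_univ, nsmul_eq_mul, hcardX, mul_one]
    have : 0 ≤ Real.log 2 := Real.log_nonneg one_le_two
    have h5 := mul_le_mul_of_nonneg_left hsum this
    simp only [T] at h5 ⊢
    nlinarith [h5]
  have hup : ∑ r, ∑ x, (1 / 2 : ℝ) ^ d r x ≤ Fintype.card R * (Fintype.card M * (3 / 2) ^ N) := by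
    have : ∀ r : R, ∑ x, (1 / 2 : ℝ) ^ d r x ≤ Fintype.card M * (3 / 2) ^ N := by
      intro r
      calc ∑ x, (1 / 2 : ℝ) ^ d r x
          ≤ ∑ x : I → Bool, ∑ m : M, (1 / 2 : ℝ) ^ #{i | guess r m i ≠ x i} :=
            sum_le_sum fun x _ => single_le_sum
              (f := fun m => (1 / 2 : ℝ) ^ #{i | guess r m i ≠ x i})
              (fun m _ => by positivity) (mem_univ (msg r x))
        _ = ∑ m : M, ∑ x : I → Bool, ∏ i, (if guess r m i ≠ x i then (1 / 2 : ℝ) else 1) := by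
            rw [sum_comm]
            refine sum_congr rfl fun m _ => sum_congr rfl fun x _ => ?_
            rw [prod_ite, prod_const, prod_const_one, mul_one]
        _ = ∑ m : M, ∏ i : I, (3 / 2 : ℝ) := by
            refine sum_congr rfl fun m _ => ?_
            have := prod_univ_sum (fun _ : I => (univ : Finset Bool))
              (fun i b => if guess r m i ≠ b then (1 / 2 : ℝ) else 1)
            rw [Fintype.piFinset_univ] at this
            rw [← this]
            refine prod_congr rfl fun i _ => ?_
            cases guess r m i <;> simp <;> norm_num
        _ = Fintype.card M * (3 / 2) ^ N := by
            rw [prod_const, sum_const, card_univ, card_univ, nsmul_eq_mul]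
    refine (sum_le_sum fun r _ => this r).trans ?_
    simp
  have hfin : (2 : ℝ) ^ N * Real.exp (-(Real.log 2 * (N / 8))) ≤ Fintype.card M * (3 / 2) ^ N := by
    have := hlow.trans hup
    simp only [T] at this
    rw [mul_assoc] at this
    exact le_of_mul_le_mul_left this hR
  have h8 := pow_le_pow_left₀ (by positivity) hfin 8
  have he : Real.exp (-(Real.log 2 * (N / 8))) ^ 8 = (1 / 2) ^ N := by
    rw [← Real.exp_nat_mul, one_div, inv_pow, ← Real.rpow_natCast,
          Real.rpow_def_of_pos two_pos, ← Real.exp_neg]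
    congr 1; push_cast; ring
  rw [mul_pow, mul_pow, he, ← pow_mul, ← pow_mul, mul_comm N 8, pow_mul, pow_mul, ← mul_pow] at h8
  -- The numerical fact is 4 · (3/2)⁸ ≤ 2⁷.
  have h9 : (4 : ℝ) ^ N * ((3 / 2) ^ 8) ^ N ≤ (2 ^ 8 * (1 / 2)) ^ N := by
    rw [← mul_pow]
    exact pow_le_pow_left₀ (by norm_num) (by norm_num) _
  have h10 := le_of_mul_le_mul_right (h9.trans h8) (by positivity)
  exact_mod_cast h10

open Finset in
theorem List.exists_finset_length_le (h : ℕ) :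
    ∃ L : Finset (List Bool), L.card + 1 ≤ 2 ^ (h + 1) ∧ ∀ H : List Bool, H.length ≤ h → H ∈ L := by
  induction h with
  | zero => exact ⟨{[]}, by simp, fun H hH => by simpa using hH⟩
  | succ h ih =>
    obtain ⟨L, hL, hm⟩ := ih
    classical
    refine ⟨{[]} ∪ (L.image (List.cons true) ∪ L.image (List.cons false)), ?_, ?_⟩
    · have h1 := card_union_le ({[]} : Finset (List Bool))
        (L.image (List.cons true) ∪ L.image (List.cons false))
      have h3 := card_union_le (L.image (List.cons true)) (L.image (List.cons false))
      have h4 := card_image_le (s := L) (f := List.cons true)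
      have h5 := card_image_le (s := L) (f := List.cons false)
      rw [card_singleton] at h1
      rw [pow_succ]
      omega
    · rintro (_ | ⟨_ | _, H⟩) hH
      · simp
      · have := hm H (by simpa using hH); simp [this]
      · have := hm H (by simpa using hH); simp [this]

theorem eight_ninths_pow_le (h : ℕ) : (8 / 9 : ℝ) ^ (6 * (h + 4)) ≤ (1 / 2) ^ (h + 4) := by
  rw [pow_mul]
  exact pow_le_pow_left₀ (by norm_num) (by norm_num) _

open Finset in
theorem card_forall_votes_lt_le {C : Type*} [Fintype C] {B : Type*} {Ls : Finset B}
    {vote : B → C → Prop} [∀ H, DecidablePred (vote H)] {h j : ℕ} (hj : j = 6 * (h + 4)) {H : B}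
    (hH : H ∈ Ls) (hE : (#{r | ¬ vote H r} : ℝ) ≤ 1 / 3 * Fintype.card C) :
    (#{r : Fin (2 * j) → C | ¬ ∃ H ∈ Ls, j ≤ #{l | vote H (r l)}} : ℝ) ≤
      1 / 8 * (Fintype.card C : ℝ) ^ (2 * j) := by
  have htail := card_filter_half_le _ j hE
  have hsub : #{r : Fin (2 * j) → C | ¬ ∃ H ∈ Ls, j ≤ #{l | vote H (r l)}} ≤
      #{r : Fin (2 * j) → C | j ≤ #{l | ¬ vote H (r l)}} := by
    refine card_le_card fun r hr => ?_
    simp only [mem_filter, mem_univ, true_and] at hr ⊢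
    push Not at hr
    have h1 := hr H hH
    have h3 := card_filter_add_card_filter_not (s := (univ : Finset (Fin (2 * j))))
      (fun l => vote H (r l))
    rw [card_univ, Fintype.card_fin] at h3
    omega
  have hpow := eight_ninths_pow_le h
  rw [← hj] at hpow
  have h18 : (1 / 2 : ℝ) ^ (h + 4) ≤ 1 / 8 :=
    calc (1 / 2 : ℝ) ^ (h + 4) ≤ (1 / 2) ^ 3 :=
          pow_le_pow_of_le_one (by norm_num) (by norm_num) (by omega)
      _ = 1 / 8 := by norm_num
  refine (Nat.cast_le.2 hsub).trans (htail.trans ?_)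
  exact mul_le_mul_of_nonneg_right (hpow.trans h18) (by positivity)

open Finset in
-- A union bound over the help messages. Their number is why `j` grows linearly with `h`: each has a
-- majority with probability at most 2^-(h+4), and there are at most 2^(h+1) of them.
theorem card_exists_le_votes_le {C : Type*} [Fintype C] {B : Type*} {Ls : Finset B}
    {vote : B → C → Prop} [∀ H, DecidablePred (vote H)] {h j : ℕ} (hj : j = 6 * (h + 4))
    (hLs : #Ls ≤ 2 ^ (h + 1)) (hE : ∀ H, (#{r | vote H r} : ℝ) ≤ 1 / 3 * Fintype.card C) :
    (#{r : Fin (2 * j) → C | ∃ H ∈ Ls, j ≤ #{l | vote H (r l)}} : ℝ) ≤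
      1 / 8 * (Fintype.card C : ℝ) ^ (2 * j) := by
  classical
  have hsub : #{r : Fin (2 * j) → C | ∃ H ∈ Ls, j ≤ #{l | vote H (r l)}} ≤
      ∑ H ∈ Ls, #{r : Fin (2 * j) → C | j ≤ #{l | vote H (r l)}} := by
    refine le_trans (card_le_card fun r hr => ?_) card_biUnion_le
    simpa using hr
  have hpow := eight_ninths_pow_le h
  rw [← hj] at hpow
  have hLs' : (#Ls : ℝ) ≤ 2 ^ (h + 1) := by exact_mod_cast hLs
  refine (Nat.cast_le.2 hsub).trans ?_
  rw [Nat.cast_sum]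
  refine (sum_le_sum fun H _ => card_filter_half_le _ j (hE H)).trans ?_
  rw [sum_const, nsmul_eq_mul, ← mul_assoc]
  refine mul_le_mul_of_nonneg_right ?_ (by positivity)
  refine (mul_le_mul hLs' hpow (by positivity) (by positivity)).trans (le_of_eq ?_)
  rw [show h + 4 = (h + 1) + 3 from rfl, pow_add (1 / 2 : ℝ), ← mul_assoc, ← mul_pow]
  norm_num

open Finset in
-- Alice runs independent copies of the scheme on `a x` and sends their memory states. Bob continues
-- with `b i` and replaces Prover by exhaustive search, so help costs no communication beyond the
-- number of repetitions.
theorem Scheme.card_le_of_index_reduction {n : ℕ} {Γ : Type} (S : Scheme n Γ)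
    (P : StreamProblem n Γ) {I : Type} [Fintype I] (a : (I → Bool) → EdgeStream n)
    (b : I → EdgeStream n) (dec : I → List Γ → Bool) (hin : ∀ x i, a x ++ b i ∈ P.inputs)
    (hdec : ∀ x i y, P.IsAnswer (a x ++ b i) y → dec i y = x i) {h v : ℕ} (hh : 1 ≤ h)
    (hv : S.SpaceAtMost v) (hS : S.Solves P h (1 / 3) (1 / 3)) :
    Fintype.card I ≤ 240 * (h * v) := by
  classical
  obtain ⟨Ls, hLs, hmem⟩ := List.exists_finset_length_le h
  obtain ⟨j, hj⟩ : ∃ j, j = 6 * (h + 4) := ⟨_, rfl⟩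
  have hC : (0 : ℝ) < Fintype.card S.Coins := by exact_mod_cast Fintype.card_pos
  let vote : (I → Bool) → I → List Bool → S.Coins → Prop := fun x i H r =>
    ∃ y, S.out r (a x ++ b i) H = some y ∧ dec i y = true
  let msg : (Fin (2 * j) → S.Coins) → (I → Bool) → (Fin (2 * j) → S.State) :=
    fun r x l => S.summary (r l) (a x)
  -- Bob answers 1 iff some help message makes at least half of the copies decode to 1. Rejection
  -- counts as a vote for 0.
  let guess : (Fin (2 * j) → S.Coins) → (Fin (2 * j) → S.State) → I → Bool := fun r m i =>
    decide (∃ H ∈ Ls, j ≤ #{l | ∃ y, S.outFrom (r l)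
      (List.foldl (S.readToken (r l)) (m l) (b i)) H = some y ∧ dec i y = true})
  have hguess : ∀ r x i, guess r (msg r x) i = true ↔ ∃ H ∈ Ls, j ≤ #{l | vote x i H (r l)} := by
    intro r x i
    simp only [guess, msg, vote, decide_eq_true_eq, Scheme.out, Scheme.summary,
      List.foldl_append]
  have hcR : (Fintype.card (Fin (2 * j) → S.Coins) : ℝ) = (Fintype.card S.Coins : ℝ) ^ (2 * j) := by
    simp
  have herr : ∀ x i, (#{r | guess r (msg r x) i ≠ x i} : ℝ) ≤
      1 / 8 * Fintype.card (Fin (2 * j) → S.Coins) := by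
    intro x i
    rw [hcR]
    cases hx : x i with
    | true =>
      obtain ⟨H, hH, hp⟩ := hS.1 _ (hin x i)
      have hE : (#{r | ¬ vote x i H r} : ℝ) ≤ 1 / 3 * Fintype.card S.Coins := by
        rw [Scheme.prob, le_div_iff₀ hC] at hp
        have h3 := card_filter_add_card_filter_not (s := (univ : Finset S.Coins)) (vote x i H)
        have h4 : (#{r | vote x i H r} : ℝ) + #{r | ¬ vote x i H r} = Fintype.card S.Coins := by
          exact_mod_cast h3
        have h5 : (1 - 1 / 3 : ℝ) * Fintype.card S.Coins ≤ #{r | vote x i H r} := by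
          refine hp.trans (Nat.cast_le.2 (card_le_card fun r hr => ?_))
          simp only [mem_filter, mem_univ, true_and] at hr ⊢
          obtain ⟨y, hy, hy'⟩ := hr
          exact ⟨y, hy, (hdec x i y hy').trans hx⟩
        linarith
      have := card_forall_votes_lt_le hj (hmem H hH) hE
      simpa only [ne_eq, hguess] using this
    | false =>
      have := card_exists_le_votes_le (Ls := Ls) (vote := vote x i) hj
        ((Nat.le_succ _).trans hLs) fun H => by
          have hp := hS.2 _ (hin x i) H
          rw [Scheme.prob, div_le_iff₀ hC] at hp
          refine le_trans (Nat.cast_le.2 (card_le_card fun r hr => ?_)) hp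
          simp only [mem_filter, mem_univ, true_and] at hr ⊢
          obtain ⟨y, hy, hy'⟩ := hr
          refine ⟨y, hy, fun hans => ?_⟩
          rw [hdec x i y hans, hx] at hy'
          exact Bool.false_ne_true hy'
      simpa only [ne_eq, Bool.not_eq_false, hguess] using this
  have hmain := four_pow_card_le_of_index_protocol msg guess herr
  have hM : Fintype.card (Fin (2 * j) → S.State) ≤ 2 ^ (v * (2 * j)) := by
    rw [Fintype.card_fun, Fintype.card_fin, pow_mul 2 v (2 * j)]
    exact Nat.pow_le_pow_left hv _
  have h1 : 2 ^ (2 * Fintype.card I) ≤ 2 ^ (v * (2 * j) * 8) := by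
    rw [pow_mul, pow_mul]
    exact hmain.trans (Nat.pow_le_pow_left hM 8)
  have h2 := (Nat.pow_le_pow_iff_right (by norm_num)).1 h1
  -- Since h ≥ 1, 6(h + 4) ≤ 30h.
  have h3 : v * j ≤ 30 * (h * v) := by
    calc v * j ≤ v * (30 * h) := Nat.mul_le_mul_left _ (by omega)
      _ = 30 * (h * v) := by ring
  have h4 : v * (2 * j) * 8 = 16 * (v * j) := by ring
  omega

/-! ### Hard instances for the lower bound -/

namespace EdgeStream

variable {n : ℕ}

/-- The stream that inserts each edge of `E` once. -/
noncomputable def ofEdges (E : Finset (Fin n × Fin n)) : EdgeStream n :=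
  E.toList.map fun e => ⟨e.1, e.2, 1⟩

theorem mem_ofEdges {E : Finset (Fin n × Fin n)} {τ : EdgeUpdate n} :
    τ ∈ ofEdges E ↔ (τ.src, τ.dst) ∈ E ∧ τ.delta = 1 := by
  rcases τ with ⟨u, v, d⟩
  simp only [ofEdges, List.mem_map, Finset.mem_toList, EdgeUpdate.mk.injEq, Prod.exists]
  constructor
  · rintro ⟨a, b, h, rfl, rfl, rfl⟩; exact ⟨h, rfl⟩
  · rintro ⟨h, rfl⟩; exact ⟨u, v, h, rfl, rfl, rfl⟩

theorem nodup_ofEdges (E : Finset (Fin n × Fin n)) : (ofEdges E).Nodup := by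
  refine (List.nodup_map_iff_inj_on E.nodup_toList).2 ?_
  rintro ⟨a, b⟩ _ ⟨c, d⟩ _ h
  simpa using h

theorem edge_iff_of_delta_eq_one {σ : EdgeStream n} (h : ∀ τ ∈ σ, τ.delta = 1) (u v : Fin n) :
    Edge σ u v ↔ ∃ τ ∈ σ, τ.src = u ∧ τ.dst = v := by
  have hcount : multiplicity σ u v = (σ.filter fun τ => τ.src = u ∧ τ.dst = v).length := by
    induction σ with
    | nil => simp [multiplicity]
    | cons τ σ ih =>
      have ih := ih fun τ' hτ' => h τ' (List.mem_cons_of_mem _ hτ')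
      have h1 := h τ List.mem_cons_self
      simp only [multiplicity, List.map_cons, List.sum_cons] at ih ⊢
      rw [ih]
      by_cases hc : τ.src = u ∧ τ.dst = v
      · simp [hc, h1]; ring
      · rw [if_neg hc, List.filter_cons_of_neg (by simpa using hc), zero_add]
  rw [Edge, hcount, Nat.cast_pos, List.length_pos_iff_exists_mem]
  simp

theorem edge_ofEdges_append (A B : Finset (Fin n × Fin n)) (u v : Fin n) :
    Edge (ofEdges A ++ ofEdges B) u v ↔ (u, v) ∈ A ∨ (u, v) ∈ B := by
  rw [edge_iff_of_delta_eq_one]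
  · constructor
    · rintro ⟨τ, hτ, rfl, rfl⟩
      rw [List.mem_append, mem_ofEdges, mem_ofEdges] at hτ
      exact hτ.imp And.left And.left
    · intro h
      refine ⟨⟨u, v, 1⟩, ?_, rfl, rfl⟩
      rw [List.mem_append, mem_ofEdges, mem_ofEdges]
      simpa using h
  · intro τ hτ
    rw [List.mem_append, mem_ofEdges, mem_ofEdges] at hτ
    exact hτ.elim And.right And.right

theorem ofEdges_append_mem_simpleVanilla {A B : Finset (Fin n × Fin n)} (hAB : Disjoint A B)
    (hA : ∀ e ∈ A, e.1 ≠ e.2) (hB : ∀ e ∈ B, e.1 ≠ e.2) :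
    ofEdges A ++ ofEdges B ∈ simpleVanilla n := by
  refine ⟨List.nodup_append'.2 ⟨nodup_ofEdges A, nodup_ofEdges B, fun τ h1 h2 => ?_⟩, ?_⟩
  · exact Finset.disjoint_left.1 hAB (mem_ofEdges.1 h1).1 (mem_ofEdges.1 h2).1
  · intro τ hτ
    rw [List.mem_append, mem_ofEdges, mem_ofEdges] at hτ
    rcases hτ with h | h
    · exact ⟨h.2, hA _ h.1⟩
    · exact ⟨h.2, hB _ h.1⟩

theorem isAcyclic_of_rank {σ : EdgeStream n} (rank : Fin n → ℕ)
    (h : ∀ u v, Edge σ u v → rank u < rank v) : IsAcyclic σ := by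
  intro v hv
  have : ∀ u w, Relation.TransGen (Edge σ) u w → rank u < rank w := by
    intro u w huw
    induction huw with
    | single h1 => exact h _ _ h1
    | tail _ h1 ih => exact ih.trans (h _ _ h1)
  exact lt_irrefl _ (this v v hv)

end EdgeStream

namespace IndexGadget

open EdgeStream

/-- Vertices of the hard instances: layer, copy, index. -/
abbrev Vertex (m : ℕ) : Type := Bool × Bool × Fin m

variable {n m : ℕ} (g : Vertex m → Fin n)

/-- In copy `c`, the first layer is joined to the second layer by the pairs where `x` is `c`. -/
noncomputable def aliceEdges (x : Fin m × Fin m → Bool) : Finset (Fin n × Fin n) := by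
  classical exact Finset.univ.image fun ij : Fin m × Fin m =>
    (g (false, x ij, ij.1), g (true, x ij, ij.2))

/-- The edges that link the two copies at the queried pair. -/
noncomputable def linkEdges (ij : Fin m × Fin m) : Finset (Fin n × Fin n) := by
  classical exact Finset.univ.image fun c : Bool =>
    (g (true, c, ij.2), g (false, !c, ij.1))

/-- The edge that closes a cycle in the copy `true` at the queried pair. -/
noncomputable def closingEdges (ij : Fin m × Fin m) : Finset (Fin n × Fin n) :=
  {(g (true, true, ij.2), g (false, true, ij.1))}

variable {g}

theorem mem_aliceEdges {x : Fin m × Fin m → Bool} {e : Fin n × Fin n} :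
    e ∈ aliceEdges g x ↔ ∃ i j, (g (false, x (i, j), i), g (true, x (i, j), j)) = e := by
  simp [aliceEdges]

theorem mem_linkEdges {ij : Fin m × Fin m} {e : Fin n × Fin n} :
    e ∈ linkEdges g ij ↔ ∃ c, (g (true, c, ij.2), g (false, !c, ij.1)) = e := by
  simp only [linkEdges, Finset.mem_image, Finset.mem_univ, true_and]

theorem mem_closingEdges {ij : Fin m × Fin m} {e : Fin n × Fin n} :
    e ∈ closingEdges g ij ↔ e = (g (true, true, ij.2), g (false, true, ij.1)) := by
  simp [closingEdges]

theorem alice_append_link_mem_simpleVanilla (hg : g.Injective) (x : Fin m × Fin m → Bool)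
    (ij : Fin m × Fin m) :
    ofEdges (aliceEdges g x) ++ ofEdges (linkEdges g ij) ∈ simpleVanilla n := by
  refine ofEdges_append_mem_simpleVanilla ?_ ?_ ?_
  · rw [Finset.disjoint_left]
    intro e h1 h2
    obtain ⟨i, j, rfl⟩ := mem_aliceEdges.1 h1
    obtain ⟨c, h⟩ := mem_linkEdges.1 h2
    have := hg (Prod.ext_iff.1 h).1
    simp at this
  · intro e h1 h
    obtain ⟨i, j, rfl⟩ := mem_aliceEdges.1 h1
    have := hg h
    simp at this
  · intro e h1 h
    obtain ⟨i, rfl⟩ := mem_linkEdges.1 h1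
    have := hg h
    simp at this

theorem alice_append_closing_mem_simpleVanilla (hg : g.Injective) (x : Fin m × Fin m → Bool)
    (ij : Fin m × Fin m) :
    ofEdges (aliceEdges g x) ++ ofEdges (closingEdges g ij) ∈ simpleVanilla n := by
  refine ofEdges_append_mem_simpleVanilla ?_ ?_ ?_
  · rw [Finset.disjoint_left]
    intro e h1 h2
    obtain ⟨i, j, rfl⟩ := mem_aliceEdges.1 h1
    have := hg (Prod.ext_iff.1 (mem_closingEdges.1 h2)).1
    simp at this
  · intro e h1 h
    obtain ⟨i, j, rfl⟩ := mem_aliceEdges.1 h1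
    have := hg h
    simp at this
  · intro e h1 h
    rw [mem_closingEdges.1 h1] at h
    have := hg h
    simp at this

/-- A height function for the instance with linked copies, where the queried bit is `c`. -/
def linkRank (c : Bool) (ij : Fin m × Fin m) : Vertex m → ℕ
  | (false, d, k) => if d = c then 2 else if k = ij.1 then 4 else 0
  | (true, d, l) => if d = c then 3 else if l = ij.2 then 1 else 5

theorem isAcyclic_link (hg : g.Injective) (x : Fin m × Fin m → Bool) (ij : Fin m × Fin m) :
    IsAcyclic (ofEdges (aliceEdges g x) ++ ofEdges (linkEdges g ij)) := by
  refine isAcyclic_of_rank (Function.extend g (linkRank (x ij) ij) 0) fun u v h => ?_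
  rw [edge_ofEdges_append, mem_aliceEdges, mem_linkEdges] at h
  rcases h with ⟨i, j, h⟩ | ⟨c, h⟩ <;> obtain ⟨rfl, rfl⟩ := Prod.ext_iff.1 h <;>
    rw [hg.extend_apply, hg.extend_apply]
  · simp only [linkRank]
    split_ifs with h1 h2 h3
    · omega
    -- The height decreases only along the queried pair in the copy that `x` did not choose, and
    -- that edge is absent.
    · subst h2; subst h3; exact absurd rfl h1
    all_goals omega
  · cases c <;> cases hx : x ij <;> simp [linkRank]

/-- With c = `x ij`, Alice's edge in copy c followed by the link out of that copy is a path between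
the two copies of the first-layer vertex `ij.1`. The queried bit thus decides which copy comes
first. -/
theorem idxOf_lt_iff (x : Fin m × Fin m → Bool) (ij : Fin m × Fin m) (y : List (Fin n))
    (hy : IsTopologicalOrder (ofEdges (aliceEdges g x) ++ ofEdges (linkEdges g ij)) y) :
    decide (y.idxOf (g (false, true, ij.1)) < y.idxOf (g (false, false, ij.1))) = x ij := by
  have h1 := hy.2.2 (g (false, x ij, ij.1)) (g (true, x ij, ij.2))
    ((edge_ofEdges_append _ _ _ _).2 (Or.inl (mem_aliceEdges.2 ⟨ij.1, ij.2, rfl⟩)))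
  have h2 := hy.2.2 (g (true, x ij, ij.2)) (g (false, !x ij, ij.1))
    ((edge_ofEdges_append _ _ _ _).2 (Or.inr (mem_linkEdges.2 ⟨x ij, rfl⟩)))
  have h3 := h1.trans h2
  cases hx : x ij <;> rw [hx] at h3
  · simpa using h3.le
  · simpa using h3

/-- If the bit is true, the closing edge reverses one of Alice's edges. If not, `linkRank false`
still increases along it, from 1 to 4. -/
theorem isAcyclic_closing_iff (hg : g.Injective) (x : Fin m × Fin m → Bool)
    (ij : Fin m × Fin m) :
    IsAcyclic (ofEdges (aliceEdges g x) ++ ofEdges (closingEdges g ij)) ↔ x ij = false := by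
  constructor
  · intro h
    by_contra hx
    rw [Bool.not_eq_false] at hx
    refine h (g (false, true, ij.1)) (.tail (.single (b := g (true, true, ij.2)) ?_) ?_)
    · exact (edge_ofEdges_append _ _ _ _).2
        (Or.inl (mem_aliceEdges.2 ⟨ij.1, ij.2, by rw [Prod.mk.eta, hx]⟩))
    · exact (edge_ofEdges_append _ _ _ _).2 (Or.inr (mem_closingEdges.2 rfl))
  · intro hx
    refine isAcyclic_of_rank (Function.extend g (linkRank false ij) 0) fun u v h => ?_
    rw [edge_ofEdges_append, mem_aliceEdges, mem_closingEdges] at h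
    rcases h with ⟨i, j, h⟩ | h <;> obtain ⟨h1, h2⟩ := Prod.ext_iff.1 h <;>
      simp only at h1 h2
    · rw [← h1, ← h2, hg.extend_apply, hg.extend_apply]
      simp only [linkRank]
      split_ifs with h1 h2 h3
      · omega
      · subst h2; subst h3; exact absurd hx h1
      all_goals omega
    · rw [h1, h2, hg.extend_apply, hg.extend_apply]
      simp [linkRank]

theorem exists_injective {n : ℕ} : ∃ g : Vertex (n / 4) → Fin n, g.Injective := by
  have : Nonempty (Vertex (n / 4) ↪ Fin n) := by
    rw [Function.Embedding.nonempty_iff_card_le]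
    simp
    omega
  exact ⟨this.some, this.some.injective⟩

end IndexGadget

theorem requiresQuadraticProduct_of_index {Γ : ℕ → Type} (P : ∀ n, StreamProblem n (Γ n))
    (H : ∀ n h v, 1 ≤ h → ∀ S : Scheme n (Γ n), S.SpaceAtMost v →
      S.Solves (P n) h (1 / 3) (1 / 3) → (n / 4) * (n / 4) ≤ 240 * (h * v)) :
    RequiresQuadraticProduct P := by
  -- For n ≥ 8 one has n ≤ 8⌊n/4⌋, and 15360 = 8² · 240.
  refine ⟨1 / 15360, by norm_num, 8, fun n hn h v hh S hv hS => ?_⟩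
  have h1 := H n h v hh S hv hS
  have h2 : n ≤ 8 * (n / 4) := by omega
  have h3 : n * n ≤ 15360 * (h * v) := by
    calc n * n ≤ (8 * (n / 4)) * (8 * (n / 4)) := Nat.mul_le_mul h2 h2
      _ = 64 * ((n / 4) * (n / 4)) := by ring
      _ ≤ 64 * (240 * (h * v)) := Nat.mul_le_mul_left _ h1
      _ = 15360 * (h * v) := by ring
  have h4 : (n : ℝ) * n ≤ 15360 * (h * v) := by exact_mod_cast h3
  linarith [sq (n : ℝ)]

theorem requiresQuadraticProduct_topoSort :
    RequiresQuadraticProduct fun n => topoSort n (EdgeStream.simpleVanilla n) := by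
  refine requiresQuadraticProduct_of_index _ fun n h v hh S hv hS => ?_
  obtain ⟨g, hg⟩ := IndexGadget.exists_injective (n := n)
  have := S.card_le_of_index_reduction (topoSort n (EdgeStream.simpleVanilla n))
    (fun x => EdgeStream.ofEdges (IndexGadget.aliceEdges g x))
    (fun ij => EdgeStream.ofEdges (IndexGadget.linkEdges g ij))
    (fun ij y => decide (y.idxOf (g (false, true, ij.1)) < y.idxOf (g (false, false, ij.1))))
    (fun x ij => ⟨IndexGadget.alice_append_link_mem_simpleVanilla hg x ij,
      IndexGadget.isAcyclic_link hg x ij⟩)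
    (fun x ij y hy => IndexGadget.idxOf_lt_iff x ij y hy) hh hv hS
  simpa using this

theorem requiresQuadraticProduct_acyclicity :
    RequiresQuadraticProduct fun n => acyclicity n (EdgeStream.simpleVanilla n) := by
  refine requiresQuadraticProduct_of_index _ fun n h v hh S hv hS => ?_
  obtain ⟨g, hg⟩ := IndexGadget.exists_injective (n := n)
  have := S.card_le_of_index_reduction (acyclicity n (EdgeStream.simpleVanilla n))
    (fun x => EdgeStream.ofEdges (IndexGadget.aliceEdges g x))
    (fun ij => EdgeStream.ofEdges (IndexGadget.closingEdges g ij))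
    (fun _ y => decide (y = [false]))
    (fun x ij => IndexGadget.alice_append_closing_mem_simpleVanilla hg x ij)
    (fun x ij y hy => by
      rcases hy with ⟨rfl, h⟩ | ⟨rfl, h⟩ <;>
        rw [IndexGadget.isAcyclic_closing_iff hg] at h
      · simp [h]
      · simpa using h) hh hv hS
  simpa using this

/-! ### Upper bound: help messages over a larger alphabet -/

/-- The decoder is total, so a dishonest bit string also decodes to a list of symbols. Soundness
then need only be shown for such lists. -/
theorem exists_blockCode {Sym : Type} [Fintype Sym] [Nonempty Sym] {ℓ : ℕ}
    (h : Fintype.card Sym ≤ 2 ^ ℓ) :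
    ∃ decode : List Bool → Sym, ∀ a, ∃ w : List Bool, w.length = ℓ ∧ decode w = a := by
  have : Nonempty (Sym ↪ List.Vector Bool ℓ) := by
    rw [Function.Embedding.nonempty_iff_card_le]
    simpa using h
  obtain ⟨f⟩ := this
  have hf : Function.Injective fun a => (f a).1 := Subtype.val_injective.comp f.injective
  exact ⟨Function.invFun fun a => (f a).1, fun a => ⟨(f a).1, (f a).2, Function.leftInverse_invFun hf a⟩⟩

section Blocks

variable {Sym : Type} (decode : List Bool → Sym) (ℓ : ℕ)

/-- Cut a bit string into blocks of length `ℓ`, the first of which starts with `w`, and decode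
the blocks; an incomplete last block is dropped. -/
def decodeBlocks : List Bool → List Bool → List Sym
  | _, [] => []
  | w, b :: H => if (w ++ [b]).length < ℓ then decodeBlocks (w ++ [b]) H
      else decode (w ++ [b]) :: decodeBlocks [] H

variable {decode ℓ}

theorem decodeBlocks_append (H : List Bool) : ∀ w' w : List Bool, w' ≠ [] →
    w.length + w'.length = ℓ →
    decodeBlocks decode ℓ w (w' ++ H) = decode (w ++ w') :: decodeBlocks decode ℓ [] H := by
  intro w'
  induction w' with
  | nil => exact fun _ h => absurd rfl h
  | cons b w' ih =>
    intro w _ hl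
    rw [List.length_cons] at hl
    rw [List.cons_append, decodeBlocks]
    by_cases hw : w' = []
    · subst hw
      rw [if_neg (by simp at hl ⊢; omega), List.nil_append]
    · have : 0 < w'.length := List.length_pos_iff.2 hw
      rw [if_pos (by simp; omega), ih (w ++ [b]) hw (by simp; omega)]
      simp

theorem exists_decodeBlocks_eq (hℓ : 0 < ℓ)
    (hdec : ∀ a, ∃ w : List Bool, w.length = ℓ ∧ decode w = a) (L : List Sym) :
    ∃ H : List Bool, H.length = ℓ * L.length ∧ decodeBlocks decode ℓ [] H = L := by
  induction L with
  | nil => exact ⟨[], by simp, rfl⟩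
  | cons a L ih =>
    obtain ⟨H, hH, hL⟩ := ih
    obtain ⟨w, hw, ha⟩ := hdec a
    refine ⟨w ++ H, ?_, ?_⟩
    · rw [List.length_append, hw, hH, List.length_cons]; ring
    · have hne : w ≠ [] := by rintro rfl; simp at hw; omega
      rw [decodeBlocks_append H w [] hne (by simpa using hw), List.nil_append, ha, hL]

end Blocks

noncomputable instance (ℓ : ℕ) : Fintype {w : List Bool // w.length < ℓ} :=
  (List.finite_length_lt Bool ℓ).fintype

theorem card_lists_length_lt_le {ℓ : ℕ} (hℓ : 0 < ℓ) :
    Fintype.card {w : List Bool // w.length < ℓ} ≤ 2 ^ ℓ := by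
  obtain ⟨L, hL, hm⟩ := List.exists_finset_length_le (ℓ - 1)
  rw [Nat.sub_add_cancel hℓ] at hL
  refine le_trans ?_ ((Nat.le_succ _).trans hL)
  rw [← Fintype.card_coe]
  exact Fintype.card_le_of_injective (fun w => (⟨w.1, hm _ (by have := w.2; omega)⟩ : L))
    fun w w' h => Subtype.ext (by simpa using h)

namespace Scheme

variable {n : ℕ} {Γ : Type} (S : Scheme n Γ)

theorem outFrom_cons (r : S.Coins) (q : S.State) (b : Bool) (H : List Bool) :
    S.outFrom r q (b :: H) =
      (S.outFrom r (S.readHelp r q b) H).map fun y => S.write r q b ++ y := rfl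

theorem prob_eq_one {E : S.Coins → Prop} (h : ∀ r, E r) : S.prob E = 1 := by
  classical
  have : (0 : ℝ) < Fintype.card S.Coins := by exact_mod_cast Fintype.card_pos
  rw [prob, Finset.filter_true_of_mem fun r _ => h r, Finset.card_univ, div_self this.ne']

theorem prob_le {E : S.Coins → Prop} {ε : ℝ} (T : Finset S.Coins) (h : ∀ r, E r → r ∈ T)
    (hT : (T.card : ℝ) ≤ ε * Fintype.card S.Coins) : S.prob E ≤ ε := by
  classical
  have : (0 : ℝ) < Fintype.card S.Coins := by exact_mod_cast Fintype.card_pos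
  rw [prob, div_le_iff₀ this]
  refine le_trans (Nat.cast_le.2 (Finset.card_le_card fun r hr => ?_)) hT
  exact h r (Finset.mem_filter.1 hr).2

end Scheme

/-- The scheme of a Verifier who reads the help message in blocks of `ℓ` bits, each of which is
decoded to a symbol. -/
noncomputable def blockScheme {n : ℕ} {Γ C Q Sym : Type} [Fintype C] [Nonempty C] [Fintype Q]
    (init : C → Q) (tok : C → Q → EdgeUpdate n → Q) (sym : C → Q → Sym → Q) (wr : Sym → List Γ)
    (fin : C → Q → Option (List Γ)) (decode : List Bool → Sym) (ℓ : ℕ) (hℓ : 0 < ℓ) :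
    Scheme n Γ where
  Coins := C
  State := Q × {w : List Bool // w.length < ℓ}
  init r := (init r, ⟨[], hℓ⟩)
  readToken r q τ := (tok r q.1 τ, q.2)
  readHelp r q b := if h : (q.2.1 ++ [b]).length < ℓ then (q.1, ⟨q.2.1 ++ [b], h⟩)
    else (sym r q.1 (decode (q.2.1 ++ [b])), ⟨[], hℓ⟩)
  write _ q b := if (q.2.1 ++ [b]).length < ℓ then [] else wr (decode (q.2.1 ++ [b]))
  finish r q := fin r q.1

section BlockScheme

variable {n : ℕ} {Γ C Q Sym : Type} [Fintype C] [Nonempty C] [Fintype Q]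
    {init : C → Q} {tok : C → Q → EdgeUpdate n → Q} {sym : C → Q → Sym → Q} {wr : Sym → List Γ}
    {fin : C → Q → Option (List Γ)} {decode : List Bool → Sym} {ℓ : ℕ} (hℓ : 0 < ℓ)

theorem blockScheme_summary (r : C) (σ : EdgeStream n) :
    (blockScheme init tok sym wr fin decode ℓ hℓ).summary r σ =
      (List.foldl (tok r) (init r) σ, ⟨[], hℓ⟩) := by
  simp only [Scheme.summary]
  change List.foldl (fun (q : Q × {w : List Bool // w.length < ℓ}) τ => (tok r q.1 τ, q.2))
    (init r, ⟨[], hℓ⟩) σ = _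
  generalize init r = q
  induction σ generalizing q with
  | nil => rfl
  | cons τ σ ih => exact ih _

theorem blockScheme_outFrom (r : C) (H : List Bool) :
    ∀ (q : Q) (w : {w : List Bool // w.length < ℓ}),
    (blockScheme init tok sym wr fin decode ℓ hℓ).outFrom r (q, w) H =
      (fin r (List.foldl (sym r) q (decodeBlocks decode ℓ w.1 H))).map
        fun y => (decodeBlocks decode ℓ w.1 H).flatMap wr ++ y := by
  induction H with
  | nil =>
    intro q w
    simp only [Scheme.outFrom, decodeBlocks, List.foldl_nil, List.flatMap_nil, List.nil_append,
      Option.map_id']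
    rfl
  | cons b H ih =>
    intro q w
    refine (Scheme.outFrom_cons _ _ _ _ _).trans ?_
    rw [decodeBlocks]
    by_cases h : (w.1 ++ [b]).length < ℓ
    · have h1 : (blockScheme init tok sym wr fin decode ℓ hℓ).readHelp r (q, w) b =
          (q, ⟨w.1 ++ [b], h⟩) := dif_pos h
      have h2 : (blockScheme init tok sym wr fin decode ℓ hℓ).write r (q, w) b = [] := if_pos h
      rw [h1, h2, ih, if_pos h]
      simp [Function.comp_def]
    · have h1 : (blockScheme init tok sym wr fin decode ℓ hℓ).readHelp r (q, w) b =
          (sym r q (decode (w.1 ++ [b])), ⟨[], hℓ⟩) := dif_neg h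
      have h2 : (blockScheme init tok sym wr fin decode ℓ hℓ).write r (q, w) b =
        wr (decode (w.1 ++ [b])) := if_neg h
      rw [h1, h2, ih, if_neg h]
      simp [Function.comp_def]

end BlockScheme

open scoped Classical in
/-- A Verifier who reads the help message symbol by symbol yields a scheme. -/
theorem exists_scheme_of_symbolVerifier {n : ℕ} {Γ C Q Sym : Type} [Fintype C] [Nonempty C]
    [Fintype Q] [Fintype Sym] [Nonempty Sym] (init : C → Q) (tok : C → Q → EdgeUpdate n → Q)
    (sym : C → Q → Sym → Q) (wr : Sym → List Γ) (fin : C → Q → Option (List Γ))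
    (P : StreamProblem n Γ) {ℓ m q c : ℕ} (hℓ : 0 < ℓ) (hSym : Fintype.card Sym ≤ 2 ^ ℓ)
    (hQ : Fintype.card Q ≤ 2 ^ q) (hC : Fintype.card C ≤ 2 ^ c)
    (complete : ∀ σ ∈ P.inputs, ∃ L : List Sym, L.length ≤ m ∧ ∀ r, ∃ y,
      fin r (List.foldl (sym r) (List.foldl (tok r) (init r) σ) L) = some y ∧
        P.IsAnswer σ (L.flatMap wr ++ y))
    (sound : ∀ σ ∈ P.inputs, ∀ L : List Sym, ((Finset.univ.filter fun r => ∃ y,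
      fin r (List.foldl (sym r) (List.foldl (tok r) (init r) σ) L) = some y ∧
        ¬ P.IsAnswer σ (L.flatMap wr ++ y)).card : ℝ) ≤ 1 / 3 * Fintype.card C) :
    ∃ S : Scheme n Γ, S.SpaceAtMost (q + ℓ) ∧ S.RandomnessAtMost c ∧
      S.Solves P (ℓ * m) 0 (1 / 3) := by
  obtain ⟨decode, hdec⟩ := exists_blockCode hSym
  have hout : ∀ (r : C) σ H, (blockScheme init tok sym wr fin decode ℓ hℓ).out r σ H =
      (fin r (List.foldl (sym r) (List.foldl (tok r) (init r) σ)
        (decodeBlocks decode ℓ [] H))).map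
          fun y => (decodeBlocks decode ℓ [] H).flatMap wr ++ y := by
    intro r σ H
    refine (congrArg (fun q => (blockScheme init tok sym wr fin decode ℓ hℓ).outFrom r q H)
      (blockScheme_summary hℓ r σ)).trans ?_
    exact blockScheme_outFrom hℓ r H _ _
  refine ⟨blockScheme init tok sym wr fin decode ℓ hℓ, ?_, hC, ?_, ?_⟩
  · change Fintype.card (Q × {w : List Bool // w.length < ℓ}) ≤ _
    rw [Fintype.card_prod, pow_add]
    exact Nat.mul_le_mul hQ (card_lists_length_lt_le hℓ)
  · intro σ hσ
    obtain ⟨L, hL, hr⟩ := complete σ hσ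
    obtain ⟨H, hH, hHL⟩ := exists_decodeBlocks_eq hℓ hdec L
    refine ⟨H, hH.trans_le (Nat.mul_le_mul_left _ hL), ?_⟩
    rw [sub_zero]
    refine (Scheme.prob_eq_one _ fun r => ?_).ge
    obtain ⟨y, hy, hans⟩ := hr r
    refine ⟨_, (hout r σ H).trans ?_, hans⟩
    rw [hHL, hy]
    rfl
  · intro σ hσ H
    refine Scheme.prob_le _ _ (fun (r : C) hr => ?_) (sound σ hσ (decodeBlocks decode ℓ [] H))
    obtain ⟨y, hy, hans⟩ := hr
    obtain ⟨y', hy', rfl⟩ := Option.map_eq_some_iff.1 ((hout r σ H).symm.trans hy)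
    exact Finset.mem_filter.2 ⟨Finset.mem_univ _, y', hy', hans⟩

/-! ### Functions of low degree in one and two variables -/

open Polynomial in
/-- The functions on a field given by polynomials of degree less than `d`. -/
noncomputable def lowDeg (F : Type*) [Field F] (d : ℕ) : Submodule F (F → F) :=
  (degreeLT F d).map (LinearMap.pi fun x => leval x)

section LowDeg

variable {F : Type*} [Field F]

open Polynomial

theorem mem_lowDeg {d : ℕ} {f : F → F} :
    f ∈ lowDeg F d ↔ ∃ q : F[X], q.degree < d ∧ ∀ x, q.eval x = f x := by
  simp only [lowDeg, Submodule.mem_map, mem_degreeLT, funext_iff, LinearMap.pi_apply,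
    leval_apply]

theorem lowDeg_mono {d e : ℕ} (h : d ≤ e) : lowDeg F d ≤ lowDeg F e := by
  intro f hf
  obtain ⟨q, hq, hf⟩ := mem_lowDeg.1 hf
  exact mem_lowDeg.2 ⟨q, hq.trans_le (by exact_mod_cast h), hf⟩

theorem const_mem_lowDeg {d : ℕ} (hd : 0 < d) (c : F) : (fun _ => c) ∈ lowDeg F d :=
  mem_lowDeg.2 ⟨C c, degree_C_le.trans_lt (by exact_mod_cast hd), fun _ => eval_C⟩

theorem mul_mem_lowDeg {d e : ℕ} {f g : F → F} (hf : f ∈ lowDeg F d) (hg : g ∈ lowDeg F e) :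
    (fun x => f x * g x) ∈ lowDeg F (d + e) := by
  obtain ⟨q, hq, hf⟩ := mem_lowDeg.1 hf
  obtain ⟨q', hq', hg⟩ := mem_lowDeg.1 hg
  by_cases h0 : q = 0
  · refine mem_lowDeg.2 ⟨0, by simp, fun x => ?_⟩
    rw [← hf, h0]; simp
  · refine mem_lowDeg.2 ⟨q * q', ?_, fun x => by rw [eval_mul, hf, hg]⟩
    by_cases h1 : q' = 0
    · rw [h1]; simp
    · rw [degree_mul, degree_eq_natDegree h0, degree_eq_natDegree h1] at *
      norm_cast at *
      omega

theorem card_zeros_lt [Fintype F] [DecidableEq F] {d : ℕ} {f : F → F} (hf : f ∈ lowDeg F d)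
    (h0 : f ≠ 0) : (Finset.univ.filter fun x => f x = 0).card < d := by
  obtain ⟨q, hq, hf⟩ := mem_lowDeg.1 hf
  have hq0 : q ≠ 0 := by
    rintro rfl
    exact h0 (funext fun x => by rw [← hf]; simp)
  have h1 : (Finset.univ.filter fun x => f x = 0) ⊆ q.roots.toFinset := by
    intro x hx
    rw [Finset.mem_filter] at hx
    rw [Multiset.mem_toFinset, mem_roots hq0, IsRoot, hf]
    exact hx.2
  refine (Finset.card_le_card h1).trans_lt ((Multiset.toFinset_card_le _).trans_lt ?_)
  have := (card_roots hq0).trans_lt hq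
  exact_mod_cast this

theorem eq_zero_of_mem_lowDeg {d : ℕ} {f : F → F} (hf : f ∈ lowDeg F d) (ν : Fin d ↪ F)
    (h : ∀ i, f (ν i) = 0) : f = 0 := by
  obtain ⟨q, hq, hf⟩ := mem_lowDeg.1 hf
  have : q = 0 := by
    refine eq_zero_of_degree_lt_of_eval_finset_eq_zero (Finset.univ.map ν) (by simpa using hq) ?_
    intro x hx
    obtain ⟨i, _, rfl⟩ := Finset.mem_map.1 hx
    rw [hf, h]
  exact funext fun x => by rw [← hf, this]; simp

theorem exists_lagrange {d : ℕ} (ν : Fin d ↪ F) :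
    ∃ δ : Fin d → F → F, (∀ u, δ u ∈ lowDeg F d) ∧ ∀ u v, δ u (ν v) = if u = v then 1 else 0 := by
  refine ⟨fun u x => (Lagrange.basis Finset.univ ν u).eval x, fun u => ?_, fun u v => ?_⟩
  · refine mem_lowDeg.2 ⟨_, ?_, fun _ => rfl⟩
    rw [Lagrange.degree_basis ν.injective.injOn (Finset.mem_univ u), Finset.card_univ,
      Fintype.card_fin]
    have := u.pos
    exact_mod_cast (by omega : d - 1 < d)
  · split_ifs with h
    · subst h
      exact Lagrange.eval_basis_self ν.injective.injOn (Finset.mem_univ _)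
    · exact Lagrange.eval_basis_of_ne h (Finset.mem_univ _)

end LowDeg

/-- The functions of two variables that have degree less than `d` in the first and less than `e`
in the second. -/
def lowDeg₂ (F : Type*) [Field F] (d e : ℕ) : Submodule F (F × F → F) where
  carrier := {f | (∀ y, (fun x => f (x, y)) ∈ lowDeg F d) ∧ ∀ x, (fun y => f (x, y)) ∈ lowDeg F e}
  add_mem' hf hg := ⟨fun y => add_mem (hf.1 y) (hg.1 y), fun x => add_mem (hf.2 x) (hg.2 x)⟩
  zero_mem' := ⟨fun _ => zero_mem _, fun _ => zero_mem _⟩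
  smul_mem' c _ hf := ⟨fun y => Submodule.smul_mem _ c (hf.1 y),
    fun x => Submodule.smul_mem _ c (hf.2 x)⟩

section LowDeg₂

variable {F : Type*} [Field F]

theorem mul_mem_lowDeg₂ {d e d' e' : ℕ} {f g : F × F → F} (hf : f ∈ lowDeg₂ F d e)
    (hg : g ∈ lowDeg₂ F d' e') : (fun r => f r * g r) ∈ lowDeg₂ F (d + d') (e + e') :=
  ⟨fun y => mul_mem_lowDeg (hf.1 y) (hg.1 y), fun x => mul_mem_lowDeg (hf.2 x) (hg.2 x)⟩

theorem tensor_mem_lowDeg₂ {d e : ℕ} {f g : F → F} (hf : f ∈ lowDeg F d) (hg : g ∈ lowDeg F e) :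
    (fun r : F × F => f r.1 * g r.2) ∈ lowDeg₂ F d e := by
  refine ⟨fun y => ?_, fun x => Submodule.smul_mem _ (f x) hg⟩
  simp_rw [mul_comm (f _)]
  exact Submodule.smul_mem _ (g y) hf

theorem lowDeg₂_mono {d e d' e' : ℕ} (hd : d ≤ d') (he : e ≤ e') :
    lowDeg₂ F d e ≤ lowDeg₂ F d' e' :=
  fun _ hf => ⟨fun y => lowDeg_mono hd (hf.1 y), fun x => lowDeg_mono he (hf.2 x)⟩

open Finset in
/-- A nonzero function of low degree has few zeros. -/
theorem card_zeros₂_le [Fintype F] [DecidableEq F] {d e : ℕ} {f : F × F → F}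
    (hf : f ∈ lowDeg₂ F d e) (h0 : f ≠ 0) :
    (univ.filter fun r => f r = 0).card ≤ (d + e) * Fintype.card F := by
  -- On the line y = y₀ the function is nonzero somewhere, so it vanishes for at most `d` values of
  -- x. Each of these may contribute a full line of zeros; every other x contributes at most `e`.
  obtain ⟨⟨x₀, y₀⟩, h0⟩ := Function.ne_iff.1 h0
  have hx : (univ.filter fun x => f (x, y₀) = 0).card ≤ d :=
    (card_zeros_lt (hf.1 y₀) (Function.ne_iff.2 ⟨x₀, h0⟩)).le
  have hy : ∀ x, f (x, y₀) ≠ 0 → (univ.filter fun y => f (x, y) = 0).card ≤ e :=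
    fun x h => (card_zeros_lt (hf.2 x) (Function.ne_iff.2 ⟨y₀, h⟩)).le
  have h1 : (univ.filter fun r => f r = 0).card =
      ∑ x, (univ.filter fun y => f (x, y) = 0).card := by
    simp only [card_filter]
    rw [Fintype.sum_prod_type]
  have h2 : ∀ x, (univ.filter fun y => f (x, y) = 0).card ≤
      (if f (x, y₀) = 0 then Fintype.card F else 0) + e := by
    intro x
    split_ifs with h
    · exact (card_le_univ _).trans (Nat.le_add_right _ _)
    · exact (hy x h).trans (Nat.le_add_left _ _)
  rw [h1]
  refine (sum_le_sum fun x _ => h2 x).trans ?_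
  rw [sum_add_distrib, ← sum_filter, sum_const, sum_const, card_univ, smul_eq_mul, smul_eq_mul,
    add_mul, mul_comm (Fintype.card F)]
  exact Nat.add_le_add_right (Nat.mul_le_mul_right _ hx) _

theorem finrank_le_of_le_lowDeg₂ [Fintype F] {d e : ℕ} (hd : d ≤ Fintype.card F)
    (he : e ≤ Fintype.card F) {V : Submodule F (F × F → F)} (hV : V ≤ lowDeg₂ F d e) :
    Module.finrank F V ≤ d * e := by
  obtain ⟨ν⟩ : Nonempty (Fin d ↪ F) := Function.Embedding.nonempty_of_card_le (by simpa using hd)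
  obtain ⟨μ⟩ : Nonempty (Fin e ↪ F) := Function.Embedding.nonempty_of_card_le (by simpa using he)
  -- Restriction to a `d` by `e` grid is injective: a function that vanishes there vanishes on whole
  -- lines, then everywhere.
  let φ : V →ₗ[F] (Fin d × Fin e → F) :=
    (LinearMap.funLeft F F fun i : Fin d × Fin e => (ν i.1, μ i.2)).comp V.subtype
  have hφ : Function.Injective φ := by
    rw [injective_iff_map_eq_zero]
    intro f hf
    have hf' : ∀ i j, f.1 (ν i, μ j) = 0 := fun i j => congrFun hf (i, j)
    have h1 : ∀ j x, f.1 (x, μ j) = 0 := fun j =>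
      congrFun (eq_zero_of_mem_lowDeg ((hV f.2).1 (μ j)) ν fun i => hf' i j)
    have h2 : ∀ x y, f.1 (x, y) = 0 := fun x =>
      congrFun (eq_zero_of_mem_lowDeg ((hV f.2).2 x) μ fun j => h1 j x)
    exact Subtype.ext (funext fun r => h2 r.1 r.2)
  have := LinearMap.finrank_le_finrank_of_injective hφ
  simpa using this

end LowDeg₂

/-! ### Class-by-class interpolation of matrices -/

/-- Data for the interpolation of functions on `Fin n × Fin n` by functions of two variables: the
first coordinate corresponds to the nodes `ν`, and the second is cut into `s` classes, each of
which is interpolated at the nodes `μ`. -/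
structure Frame (F : Type) [Field F] (n s t : ℕ) where
  cls : Fin n → Fin s
  col : Fin n → Fin t
  cls_col : ∀ u v, cls u = cls v → col u = col v → u = v
  ν : Fin n ↪ F
  μ : Fin t ↪ F
  δ : Fin n → F → F
  ε : Fin t → F → F
  η : F → F
  δ_mem : ∀ u, δ u ∈ lowDeg F n
  ε_mem : ∀ a, ε a ∈ lowDeg F t
  η_mem : η ∈ lowDeg F t
  δ_node : ∀ u v, δ u (ν v) = if u = v then 1 else 0
  ε_node : ∀ a b, ε a (μ b) = if a = b then 1 else 0
  sum_η : ∑ a, η (μ a) = 1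

theorem Frame.exists {F : Type} [Field F] [Fintype F] {n s t : ℕ} (ht : 0 < t) (hts : n ≤ t * s)
    (hn : n ≤ Fintype.card F) (htF : t ≤ Fintype.card F) : Nonempty (Frame F n s t) := by
  obtain ⟨ν⟩ : Nonempty (Fin n ↪ F) := Function.Embedding.nonempty_of_card_le (by simpa using hn)
  obtain ⟨μ⟩ : Nonempty (Fin t ↪ F) := Function.Embedding.nonempty_of_card_le (by simpa using htF)
  obtain ⟨δ, hδ, hδ'⟩ := exists_lagrange ν
  obtain ⟨ε, hε, hε'⟩ := exists_lagrange μ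
  obtain ⟨g⟩ : Nonempty (Fin n ↪ Fin t × Fin s) :=
    Function.Embedding.nonempty_of_card_le (by simpa using hts)
  -- Any function of degree below `t` with node sum 1 can serve as `η`; a Lagrange basis function is
  -- one.
  refine ⟨⟨fun v => (g v).2, fun v => (g v).1, fun u v h1 h2 => g.injective (Prod.ext h2 h1), ν, μ,
    δ, ε, ε ⟨0, ht⟩, hδ, hε, hε _, hδ', hε', ?_⟩⟩
  simp [hε']

namespace Frame

variable {F : Type} [Field F] {n s t : ℕ} (φ : Frame F n s t)

/-- The interpolation of a function on the vertices, class by class. -/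
def spread (f : Fin n → F) (y : F) (b : Fin s) : F :=
  ∑ v, if φ.cls v = b then f v * φ.ε (φ.col v) y else 0

/-- The interpolation of a function on pairs of vertices. -/
def bispread (g : Fin n → Fin n → F) (r : F × F) (b : Fin s) : F :=
  ∑ u, φ.δ u r.1 * φ.spread (g u) r.2 b

theorem spread_add (f f' : Fin n → F) (y : F) (b : Fin s) :
    φ.spread (fun v => f v + f' v) y b = φ.spread f y b + φ.spread f' y b := by
  simp only [spread, ← Finset.sum_add_distrib]
  refine Finset.sum_congr rfl fun v _ => ?_
  split_ifs <;> ring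

theorem spread_smul (c : F) (f : Fin n → F) (y : F) (b : Fin s) :
    φ.spread (fun v => c * f v) y b = c * φ.spread f y b := by
  simp only [spread, Finset.mul_sum]
  refine Finset.sum_congr rfl fun v _ => ?_
  split_ifs <;> ring

theorem spread_zero (y : F) (b : Fin s) : φ.spread (fun _ => 0) y b = 0 := by
  simp [spread]

theorem bispread_add (g g' : Fin n → Fin n → F) (r : F × F) (b : Fin s) :
    φ.bispread (fun u v => g u v + g' u v) r b = φ.bispread g r b + φ.bispread g' r b := by
  simp only [bispread, spread_add, mul_add, Finset.sum_add_distrib]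

theorem bispread_zero (r : F × F) (b : Fin s) : φ.bispread (fun _ _ => 0) r b = 0 := by
  simp [bispread, spread_zero]

/-- Announcing `u` changes only row `u` of the prefix matrix. The interpolation of that matrix at
`r` can therefore be updated from the current `spread` alone. -/
theorem bispread_row (u : Fin n) (f : Fin n → F) (r : F × F) (b : Fin s) :
    φ.bispread (fun u' v => if u = u' then f v else 0) r b =
      φ.δ u r.1 * φ.spread f r.2 b := by
  rw [bispread, Finset.sum_eq_single u]
  · simp
  · intro v _ hv
    simp only [if_neg hv.symm, spread_zero, mul_zero]
  · simp

/-- The matrix of the cycle check has rank one, so one scalar and the vector `W` determine its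
interpolation at `r`. -/
theorem bispread_tensor (w f : Fin n → F) (r : F × F) (b : Fin s) :
    φ.bispread (fun u v => w u * f v) r b = (∑ u, w u * φ.δ u r.1) * φ.spread f r.2 b := by
  simp only [bispread, spread_smul, Finset.sum_mul]
  exact Finset.sum_congr rfl fun u _ => by ring

theorem spread_mem (f : Fin n → F) (b : Fin s) : (fun y => φ.spread f y b) ∈ lowDeg F t := by
  have : (fun y => φ.spread f y b) =
      ∑ v, if φ.cls v = b then f v • φ.ε (φ.col v) else 0 := by
    ext y
    rw [Finset.sum_apply, spread]
    refine Finset.sum_congr rfl fun v _ => ?_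
    split_ifs <;> rfl
  rw [this]
  refine sum_mem fun v _ => ?_
  split_ifs
  · exact Submodule.smul_mem _ _ (φ.ε_mem _)
  · exact zero_mem _

theorem sum_δ_mem (w : Fin n → F) : (fun x => ∑ u, w u * φ.δ u x) ∈ lowDeg F n := by
  have : (fun x => ∑ u, w u * φ.δ u x) = ∑ u, w u • φ.δ u := by
    ext x; simp
  rw [this]
  exact sum_mem fun u _ => Submodule.smul_mem _ _ (φ.δ_mem u)

theorem bispread_mem (g : Fin n → Fin n → F) (b : Fin s) :
    (fun r => φ.bispread g r b) ∈ lowDeg₂ F n t := by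
  have : (fun r => φ.bispread g r b) = ∑ u, fun r : F × F => φ.δ u r.1 * φ.spread (g u) r.2 b := by
    ext r; simp [bispread]
  rw [this]
  exact sum_mem fun u _ => tensor_mem_lowDeg₂ (φ.δ_mem u) (φ.spread_mem _ _)

theorem spread_node (f : Fin n → F) (v : Fin n) :
    φ.spread f (φ.μ (φ.col v)) (φ.cls v) = f v := by
  rw [spread, Finset.sum_eq_single v]
  · simp [φ.ε_node]
  · intro u _ hu
    split_ifs with h
    · rw [φ.ε_node, if_neg fun h' => hu (φ.cls_col u v h h'), mul_zero]
    · rfl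
  · simp

theorem bispread_node (g : Fin n → Fin n → F) (u : Fin n) (y : F) (b : Fin s) :
    φ.bispread g (φ.ν u, y) b = φ.spread (g u) y b := by
  rw [bispread, Finset.sum_eq_single u]
  · simp [φ.δ_node]
  · intro v _ hv; simp [φ.δ_node, hv]
  · simp

theorem sum_δ_node (w : Fin n → F) (u : Fin n) : ∑ u', w u' * φ.δ u' (φ.ν u) = w u := by
  simp [φ.δ_node]

/-- Each vertex occupies its own point of the grid of nodes and classes, and interpolations vanish
at the unoccupied points. The product may exceed degree `t`, but only its values on the grid enter.
-/
theorem sum_spread_mul_spread (f f' : Fin n → F) :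
    ∑ a, ∑ b, φ.spread f (φ.μ a) b * φ.spread f' (φ.μ a) b = ∑ v, f v * f' v := by
  have : ∀ v, ∑ a, ∑ b, φ.spread f (φ.μ a) b *
      (if φ.cls v = b then f' v * φ.ε (φ.col v) (φ.μ a) else 0) = f v * f' v := by
    intro v
    simp_rw [mul_ite, mul_zero, Finset.sum_ite_eq, Finset.mem_univ, if_true, φ.ε_node, mul_ite,
      mul_one, mul_zero, Finset.sum_ite_eq, Finset.mem_univ, if_true, φ.spread_node]
  refine Eq.trans ?_ (Finset.sum_congr rfl fun v _ => this v)
  refine Eq.trans (Finset.sum_congr rfl fun a _ => ?_) Finset.sum_comm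
  refine Eq.trans (Finset.sum_congr rfl fun b _ => ?_) Finset.sum_comm
  rw [← Finset.mul_sum]
  rfl

/-- The inner product, class by class, of the interpolations of two functions on pairs. -/
def pairing (g g' : Fin n → Fin n → F) (r : F × F) : F :=
  ∑ b, φ.bispread g r b * φ.bispread g' r b

theorem pairing_mem (g g' : Fin n → Fin n → F) : φ.pairing g g' ∈ lowDeg₂ F (n + n) (t + t) := by
  have : φ.pairing g g' = ∑ b, fun r => φ.bispread g r b * φ.bispread g' r b := by
    ext r; simp [pairing]
  rw [this]
  exact sum_mem fun b _ => mul_mem_lowDeg₂ (φ.bispread_mem g b) (φ.bispread_mem g' b)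

theorem sum_pairing_node (g g' : Fin n → Fin n → F) (u : Fin n) :
    ∑ a, φ.pairing g g' (φ.ν u, φ.μ a) = ∑ v, g u v * g' u v := by
  simp_rw [pairing, bispread_node]
  exact φ.sum_spread_mul_spread _ _

/-- The functions of low degree all of whose row sums over the nodes vanish. -/
def vanishing : Submodule F (F × F → F) where
  carrier := {Q | Q ∈ lowDeg₂ F (n + n) (t + t) ∧ ∀ u, ∑ a, Q (φ.ν u, φ.μ a) = 0}
  add_mem' hf hg := ⟨add_mem hf.1 hg.1, fun u => by
    simp only [Pi.add_apply, Finset.sum_add_distrib, hf.2, hg.2, add_zero]⟩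
  zero_mem' := ⟨zero_mem _, fun u => by simp⟩
  smul_mem' c _ hf := ⟨Submodule.smul_mem _ _ hf.1, fun u => by
    simp only [Pi.smul_apply, ← Finset.smul_sum, hf.2, smul_zero]⟩

end Frame

/-! ### Prefix counts of an announced order -/

/-- The number of pairs of positions `i ≤ j` of the reversal of the list that hold `v` and `u`. -/
def suffixCount {α : Type*} [DecidableEq α] : List α → α → α → ℕ
  | [], _, _ => 0
  | x :: l, u, v => suffixCount l u v + if x = u then (x :: l).count v else 0

/-- The number of pairs of positions `i ≤ j` of the list that hold `v` and `u`. -/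
def prefixCount {α : Type*} [DecidableEq α] (l : List α) (u v : α) : ℕ :=
  suffixCount l.reverse u v

theorem prefixCount_nil {α : Type*} [DecidableEq α] (u v : α) : prefixCount [] u v = 0 := rfl

theorem prefixCount_concat {α : Type*} [DecidableEq α] (l : List α) (x u v : α) :
    prefixCount (l ++ [x]) u v = prefixCount l u v + if x = u then (l ++ [x]).count v else 0 := by
  rw [prefixCount, List.reverse_append, List.reverse_singleton, List.singleton_append, suffixCount,
    prefixCount]
  congr 2
  rw [← List.count_reverse]
  simp

theorem prefixCount_eq_zero {α : Type*} [DecidableEq α] {l : List α} {u v : α}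
    (h : u ∉ l ∨ v ∉ l) : prefixCount l u v = 0 := by
  induction l using List.reverseRecOn with
  | nil => rfl
  | append_singleton l x ih =>
    rw [prefixCount_concat, ih (h.imp (mt (List.mem_append_left _)) (mt (List.mem_append_left _))),
      zero_add]
    split_ifs with hx
    · refine List.count_eq_zero_of_not_mem (h.resolve_left fun h' => h' ?_)
      simp [hx]
    · rfl

/-- The value for `u = v` is 1, since a position is paired with itself. Hence a loop also counts as
a violated edge. -/
theorem prefixCount_of_nodup {α : Type*} [DecidableEq α] {l : List α} (hl : l.Nodup) {u v : α}
    (hu : u ∈ l) (hv : v ∈ l) :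
    prefixCount l u v = if l.idxOf u < l.idxOf v then 0 else 1 := by
  induction l using List.reverseRecOn with
  | nil => simp at hu
  | append_singleton l x ih =>
    have hx : x ∉ l := by
      have := List.nodup_append.1 hl
      intro h
      exact this.2.2 x h x (by simp) rfl
    have hl' : l.Nodup := (List.nodup_append.1 hl).1
    rw [prefixCount_concat]
    by_cases hux : x = u
    · subst hux
      rw [prefixCount_eq_zero (Or.inl hx), zero_add, if_pos rfl, List.count_eq_one_of_mem hl hv,
        if_neg]
      have h1 : (l ++ [x]).idxOf x = l.length := by
        rw [List.idxOf_append_of_notMem hx]; simp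
      have h2 := List.idxOf_lt_length_of_mem hv
      rw [List.length_append, List.length_singleton] at h2
      omega
    · have hul : u ∈ l := by
        rcases List.mem_append.1 hu with h | h
        · exact h
        · exact absurd (List.mem_singleton.1 h).symm hux
      rw [if_neg hux, add_zero, List.idxOf_append_of_mem hul]
      by_cases hvx : v = x
      · subst hvx
        rw [prefixCount_eq_zero (Or.inr hx), if_pos]
        rw [List.idxOf_append_of_notMem hx]
        exact (List.idxOf_lt_length_of_mem hul).trans_le (Nat.le_add_right _ _)
      · have hvl : v ∈ l := by
          rcases List.mem_append.1 hv with h | h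
          · exact h
          · exact absurd (List.mem_singleton.1 h) hvx
        rw [List.idxOf_append_of_mem hvl, ih hl' hul hvl]

/-! ### Verifier's memory and the help symbols -/

/-- The part of Verifier's memory that changes while he reads the help message. -/
structure HelpState (F : Type) (n s : ℕ) where
  W : Fin s → F
  B : Fin s → F
  α : F
  E : F
  G : F
  cnt : Fin (n + 2)
  mode : Bool

namespace HelpState

variable {F : Type} {n s : ℕ}

theorem toProd_injective : Function.Injective fun h : HelpState F n s =>
    (h.W, h.B, h.α, h.E, h.G, h.cnt, h.mode) := by
  rintro ⟨⟩ ⟨⟩ h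
  simpa using h

noncomputable instance [Fintype F] : Fintype (HelpState F n s) := by
  classical exact Fintype.ofInjective _ toProd_injective

theorem card_le [Fintype F] :
    Fintype.card (HelpState F n s) ≤ Fintype.card F ^ (2 * s + 3) * ((n + 2) * 2) := by
  refine (Fintype.card_le_of_injective _ toProd_injective).trans (le_of_eq ?_)
  simp only [Fintype.card_prod, Fintype.card_fun, Fintype.card_fin, Fintype.card_bool]
  ring

end HelpState

namespace Frame

variable {F : Type} [Field F] {n s t : ℕ} (φ : Frame F n s t)

/-- The symbols of the help message: `inl (u, w, c)` announces the vertex `u` with weight `w` and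
sets the mode to `c`; `inr (k, c)` is a coefficient with respect to a basis of the vanishing
functions. -/
abbrev Symbol : Type := (Fin n × F × Bool) ⊕ (Fin (Module.finrank F φ.vanishing) × F)

/-- The update of the sketch of the input by a token. -/
def readSketch (r : F × F) (A : Fin s → F) (τ : EdgeUpdate n) : Fin s → F := fun b =>
  A b + φ.bispread (fun u v => if τ.src = u ∧ τ.dst = v then (τ.delta : F) else 0) r b

theorem foldl_readSketch (r : F × F) (σ : EdgeStream n) (A : Fin s → F) :
    List.foldl (φ.readSketch r) A σ = fun b =>
      A b + φ.bispread (fun u v => (σ.multiplicity u v : F)) r b := by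
  induction σ generalizing A with
  | nil => simp [EdgeStream.multiplicity, bispread_zero]
  | cons τ σ ih =>
    rw [List.foldl_cons, ih]
    ext b
    rw [readSketch, add_assoc, ← bispread_add]
    congr 2
    ext u v
    simp only [EdgeStream.multiplicity, List.map_cons, List.sum_cons, Int.cast_add, Int.cast_ite,
      Int.cast_zero]

/-- A basis of the vanishing functions. -/
noncomputable def vanishingBasis [Fintype F] (k : Fin (Module.finrank F φ.vanishing)) :
    F × F → F :=
  (Module.finBasis F φ.vanishing k).1

/-- The update of the memory by a symbol of the help message. -/
noncomputable def readSymbol [Fintype F] (r : F × F) (h : HelpState F n s) :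
    φ.Symbol → HelpState F n s
  | .inl (u, w, c) =>
    { W := fun b => h.W b + φ.spread (fun v => if u = v then 1 else 0) r.2 b
      -- The new row uses `W` after the update, so that the pair (u, u) is counted.
      B := fun b => h.B b +
        φ.δ u r.1 * (h.W b + φ.spread (fun v => if u = v then 1 else 0) r.2 b)
      α := h.α + w * φ.δ u r.1
      E := h.E + φ.δ u r.1
      G := h.G
      -- The counter saturates at n + 1, which is enough to tell whether more than n vertices were
      -- announced.
      cnt := ⟨min (h.cnt + 1) (n + 1), by omega⟩
      mode := c }
  | .inr (k, c) => { h with G := h.G + c * φ.vanishingBasis k r }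

/-- The memory before the help message. -/
def helpInit : HelpState F n s := ⟨0, 0, 0, 0, 0, 0, true⟩

/-- The vertex announced by a symbol, if any. -/
def vertexOf : φ.Symbol → List (Fin n)
  | .inl (u, _, _) => [u]
  | .inr _ => []

/-- The weight that a symbol gives to the vertex `v`. -/
def weightOf (v : Fin n) : φ.Symbol → F
  | .inl (u, w, _) => if u = v then w else 0
  | .inr _ => 0

/-- The vanishing function described by a symbol. -/
noncomputable def functionOf [Fintype F] : φ.Symbol → (F × F → F)
  | .inl _ => 0
  | .inr (k, c) => c • φ.vanishingBasis k

/-- The mode after a symbol. -/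
def modeAfter (m : Bool) : φ.Symbol → Bool
  | .inl (_, _, c) => c
  | .inr _ => m

/-- The vertices announced in a help message. -/
def vertices (L : List φ.Symbol) : List (Fin n) := L.flatMap φ.vertexOf

/-- The total weight of a vertex in a help message. -/
def weight (L : List φ.Symbol) (v : Fin n) : F := (L.map (φ.weightOf v)).sum

/-- The vanishing function described by a help message. -/
noncomputable def function [Fintype F] (L : List φ.Symbol) : F × F → F := (L.map φ.functionOf).sum

/-- The mode after a help message. -/
def mode (L : List φ.Symbol) : Bool := L.foldl φ.modeAfter true

theorem function_mem [Fintype F] (L : List φ.Symbol) : φ.function L ∈ φ.vanishing := by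
  refine list_sum_mem fun f hf => ?_
  obtain ⟨a, _, rfl⟩ := List.mem_map.1 hf
  rcases a with ⟨u, w, c⟩ | ⟨k, c⟩
  · exact zero_mem _
  · exact Submodule.smul_mem _ c (Module.finBasis F φ.vanishing k).2

/-- In closed form, the field elements in memory are values at `r` of low-degree functions fixed by
the message, while `cnt` and `mode` do not depend on `r`. This turns the checks into polynomial
identities tested at a random point. -/
theorem foldl_readSymbol [Fintype F] (r : F × F) (L : List φ.Symbol) :
    List.foldl (φ.readSymbol r) helpInit L =
      { W := φ.spread (fun v => ((φ.vertices L).count v : F)) r.2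
        B := φ.bispread (fun u v => (prefixCount (φ.vertices L) u v : F)) r
        α := ∑ u, φ.weight L u * φ.δ u r.1
        E := ∑ u, ((φ.vertices L).count u : F) * φ.δ u r.1
        G := φ.function L r
        cnt := ⟨min (φ.vertices L).length (n + 1), by omega⟩
        mode := φ.mode L } := by
  induction L using List.reverseRecOn with
  | nil =>
    simp only [List.foldl_nil, helpInit, vertices, weight, function, mode, List.flatMap_nil,
      List.count_nil, List.map_nil, List.sum_nil, prefixCount_nil, Nat.cast_zero, zero_mul,
      Finset.sum_const_zero, HelpState.mk.injEq]
    refine ⟨?_, ?_, trivial, trivial, rfl, rfl, trivial⟩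
    · ext b; simp [spread_zero]
    · ext b; simp [bispread_zero]
  | append_singleton L a ih =>
    rw [List.foldl_append, ih, List.foldl_cons, List.foldl_nil]
    have hmode : φ.mode (L ++ [a]) = φ.modeAfter (φ.mode L) a := by
      simp [mode, List.foldl_append]
    have hweight : ∀ v, φ.weight (L ++ [a]) v = φ.weight L v + φ.weightOf v a := by
      simp [weight]
    have hfun : φ.function (L ++ [a]) = φ.function L + φ.functionOf a := by
      simp [function]
    have hvert : φ.vertices (L ++ [a]) = φ.vertices L ++ φ.vertexOf a := by
      simp [vertices]
    simp only [hmode, hfun, hvert, hweight]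
    rcases a with ⟨u, w, c⟩ | ⟨k, c⟩
    · have hcount : ∀ v, (((φ.vertices L ++ [u]).count v : ℕ) : F) =
          (φ.vertices L).count v + if u = v then 1 else 0 := by
        intro v
        rw [List.count_append, Nat.cast_add, List.count_singleton]
        simp
      simp only [readSymbol, vertexOf, weightOf, functionOf, modeAfter, HelpState.mk.injEq,
        add_zero, and_true, true_and, prefixCount_concat, Nat.cast_add, Nat.cast_ite, Nat.cast_zero,
        hcount, add_mul, Finset.sum_add_distrib,
        ite_mul, one_mul, zero_mul, Finset.sum_ite_eq, Finset.mem_univ, if_true,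
        List.length_append, List.length_singleton, Fin.mk.injEq]
      refine ⟨?_, ?_, ?_⟩
      · ext b; rw [spread_add]
      · ext b; rw [bispread_add, bispread_row, spread_add]
      · omega
    · simp [readSymbol, vertexOf, weightOf, functionOf, modeAfter]

end Frame

/-! ### Small integers modulo p; sinks and topological orders -/

theorem CharP.intCast_eq_zero_of_lt {F : Type*} [Ring F] {p : ℕ} [CharP F p] {k : ℤ} (h0 : 0 ≤ k)
    (hp : k < p) (h : (k : F) = 0) : k = 0 :=
  Int.eq_zero_of_dvd_of_nonneg_of_lt h0 hp ((CharP.intCast_eq_zero_iff F p k).1 h)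

namespace EdgeStream

variable {n : ℕ} {σ : EdgeStream n}

/-- In an acyclic digraph every nonempty set of vertices has a sink. -/
theorem IsAcyclic.exists_sink (h : σ.IsAcyclic) {S : Set (Fin n)} (hS : S.Nonempty) :
    ∃ u ∈ S, ∀ v ∈ S, ¬ σ.Edge u v := by
  have : Std.Irrefl (Function.swap (Relation.TransGen σ.Edge)) := ⟨h⟩
  have : IsTrans (Fin n) (Function.swap (Relation.TransGen σ.Edge)) :=
    ⟨fun a b c hab hbc => Relation.TransGen.trans hbc hab⟩
  have hwf := Finite.wellFounded_of_trans_of_irrefl (Function.swap (Relation.TransGen σ.Edge))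
  obtain ⟨u, hu, hmin⟩ := hwf.has_min S hS
  exact ⟨u, hu, fun v hv huv => hmin v hv (.single huv)⟩

/-- In a digraph with a cycle some nonempty set of vertices has no sink. -/
theorem exists_forall_edge_of_not_isAcyclic (h : ¬ σ.IsAcyclic) :
    ∃ S : Set (Fin n), S.Nonempty ∧ ∀ u ∈ S, ∃ v ∈ S, σ.Edge u v := by
  simp only [IsAcyclic, not_forall, not_not] at h
  obtain ⟨w, hw⟩ := h
  refine ⟨{v | Relation.TransGen σ.Edge v w}, ⟨w, hw⟩, fun u hu => ?_⟩
  obtain ⟨x, hux, hxw⟩ := Relation.TransGen.head'_iff.1 hu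
  rcases Relation.reflTransGen_iff_eq_or_transGen.1 hxw with h | h
  · exact ⟨w, hw, h ▸ hux⟩
  · exact ⟨x, h, hux⟩

theorem IsTopologicalOrder.isAcyclic {l : List (Fin n)} (h : σ.IsTopologicalOrder l) :
    σ.IsAcyclic := by
  intro v hv
  have : ∀ u w, Relation.TransGen σ.Edge u w → l.idxOf u < l.idxOf w := by
    intro u w huw
    induction huw with
    | single h1 => exact h.2.2 _ _ h1
    | tail _ h1 ih => exact ih.trans (h.2.2 _ _ h1)
  exact lt_irrefl _ (this v v hv)

theorem IsTopologicalOrder.length_eq {l : List (Fin n)} (h : σ.IsTopologicalOrder l) :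
    l.length = n := by
  have h1 : l.toFinset = Finset.univ :=
    Finset.eq_univ_iff_forall.2 fun v => List.mem_toFinset.2 (h.2.1 v)
  rw [← List.toFinset_card_of_nodup h.1, h1, Finset.card_univ, Fintype.card_fin]

theorem IsAcyclic.exists_isTopologicalOrder (h : σ.IsAcyclic) :
    ∃ l, σ.IsTopologicalOrder l := by
  have key : ∀ S : Finset (Fin n), ∃ l : List (Fin n), l.Nodup ∧ (∀ v, v ∈ l ↔ v ∈ S) ∧
      ∀ u ∈ S, ∀ v ∈ S, σ.Edge u v → l.idxOf u < l.idxOf v := by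
    intro S
    induction S using Finset.strongInduction with
    | H S ih =>
      rcases S.eq_empty_or_nonempty with rfl | hS
      · exact ⟨[], by simp⟩
      · obtain ⟨x, hx, hsink⟩ := h.exists_sink (S := (S : Set (Fin n))) hS
        obtain ⟨l, hl, hmem, hord⟩ := ih (S.erase x) (Finset.erase_ssubset hx)
        have hxl : x ∉ l := by simp [hmem]
        refine ⟨l ++ [x], ?_, ?_, ?_⟩
        · exact hl.append (List.nodup_singleton x) (by simpa using hxl)
        · intro v
          rw [List.mem_append, hmem, Finset.mem_erase, List.mem_singleton]
          by_cases hv : v = x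
          · simp [hv, Finset.mem_coe.1 hx]
          · simp [hv]
        · intro u hu v hv huv
          have hux : u ≠ x := by
            rintro rfl
            exact hsink v hv huv
          have hul : u ∈ l := (hmem u).2 (Finset.mem_erase.2 ⟨hux, hu⟩)
          rw [List.idxOf_append_of_mem hul]
          by_cases hvx : v = x
          · subst hvx
            rw [List.idxOf_append_of_notMem hxl]
            exact (List.idxOf_lt_length_of_mem hul).trans_le (Nat.le_add_right _ _)
          · have hvl := Finset.mem_erase.2 ⟨hvx, hv⟩
            rw [List.idxOf_append_of_mem ((hmem v).2 hvl)]
            exact hord u (Finset.mem_erase.2 ⟨hux, hu⟩) v hvl huv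
  obtain ⟨l, hl, hmem, hord⟩ := key Finset.univ
  exact ⟨l, hl, fun v => (hmem v).2 (Finset.mem_univ v),
    fun u v huv => hord u (Finset.mem_univ u) v (Finset.mem_univ v) huv⟩

end EdgeStream

/-! ### Soundness and completeness of the two checks -/

namespace Frame

variable {F : Type} [Field F] {n s t : ℕ} (φ : Frame F n s t)

/-- Verifier's final check that the announced vertices form a topological order. -/
def OrderCheck (r : F × F) (A : Fin s → F) (h : HelpState F n s) : Prop :=
  h.cnt.val ≤ n ∧ (∀ b, h.W b = φ.spread (fun _ => 1) r.2 b) ∧ ∑ b, A b * h.B b = h.G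

/-- Verifier's final check that each announced vertex has an edge to an announced vertex. -/
def CycleCheck (r : F × F) (A : Fin s → F) (h : HelpState F n s) : Prop :=
  h.cnt.val ≤ n ∧ h.α * ∑ b, A b * h.W b = h.E * φ.η r.2 + h.G

/-- The mode starts as `true` and only an announcement changes it. This keeps the empty set, which
has no sink vacuously, from proving a cycle. -/
theorem vertices_ne_nil_of_mode {L : List φ.Symbol} (h : φ.mode L = false) :
    φ.vertices L ≠ [] := by
  contrapose! h
  have : ∀ m, L.foldl φ.modeAfter m = m := by
    intro m
    induction L with
    | nil => rfl
    | cons a L ih =>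
      rcases a with ⟨u, w, c⟩ | ⟨k, c⟩
      · simp [vertices, vertexOf] at h
      · rw [List.foldl_cons]
        exact ih (by simpa [vertices, vertexOf] using h)
  rw [mode, this]
  decide

/-- The help message that announces the vertices of `l` with weights `w` in the mode `m`, and
describes the vanishing function with coefficients `c`. -/
noncomputable def message (l : List (Fin n)) (w : Fin n → F) (m : Bool)
    (c : Fin (Module.finrank F φ.vanishing) → F) : List φ.Symbol :=
  (l.map fun u => .inl (u, w u, m)) ++ (List.finRange _).map fun k => .inr (k, c k)

section Message

variable (l : List (Fin n)) (w : Fin n → F) (m : Bool)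
  (c : Fin (Module.finrank F φ.vanishing) → F)

theorem length_message : (φ.message l w m c).length = l.length + Module.finrank F φ.vanishing := by
  simp [message]

theorem vertices_message : φ.vertices (φ.message l w m c) = l := by
  simp [message, vertices, List.flatMap_append, List.flatMap_map, vertexOf]

theorem function_message [Fintype F] : φ.function (φ.message l w m c) =
    ((List.finRange _).map fun k => c k • φ.vanishingBasis k).sum := by
  simp [message, function, Function.comp_def, functionOf]

theorem weight_message (u : Fin n) :
    φ.weight (φ.message l w m c) u = l.count u * w u := by
  have h1 : φ.weight (φ.message l w m c) u = (l.map fun v => if v = u then w v else 0).sum := by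
    simp [message, weight, Function.comp_def, weightOf]
  rw [h1]
  induction l with
  | nil => simp
  | cons x l ih =>
    rw [List.map_cons, List.sum_cons, ih (by simp [message, weight, Function.comp_def, weightOf]),
      List.count_cons]
    by_cases hx : x = u
    · subst hx
      simp; ring
    · simp [hx]

theorem mode_message (h : l ≠ [] ∨ m = true) : φ.mode (φ.message l w m c) = m := by
  have h1 : ∀ (K : List (Fin (Module.finrank F φ.vanishing))) (m' : Bool),
      (K.map fun k => (.inr (k, c k) : φ.Symbol)).foldl φ.modeAfter m' = m' := by
    intro K
    induction K with
    | nil => exact fun _ => rfl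
    | cons k K ih => exact fun m' => ih m'
  rw [mode, message, List.foldl_append, h1]
  induction l using List.reverseRecOn with
  | nil => exact (h.resolve_left fun h => h rfl).symm
  | append_singleton l u _ => simp [modeAfter]

end Message

variable [Fintype F]

theorem orderCheck_iff (r : F × F) (g : Fin n → Fin n → F) (L : List φ.Symbol) :
    φ.OrderCheck r (φ.bispread g r) (List.foldl (φ.readSymbol r) helpInit L) ↔
      (φ.vertices L).length ≤ n ∧
      (∀ b, φ.spread (fun v => ((φ.vertices L).count v : F)) r.2 b =
        φ.spread (fun _ => 1) r.2 b) ∧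
      φ.pairing g (fun u v => (prefixCount (φ.vertices L) u v : F)) r = φ.function L r := by
  rw [foldl_readSymbol, OrderCheck]
  refine and_congr ?_ Iff.rfl
  simp only
  omega

theorem cycleCheck_iff (r : F × F) (g : Fin n → Fin n → F) (L : List φ.Symbol) :
    φ.CycleCheck r (φ.bispread g r) (List.foldl (φ.readSymbol r) helpInit L) ↔
      (φ.vertices L).length ≤ n ∧
      φ.pairing g (fun u v => φ.weight L u * ((φ.vertices L).count v : F)) r =
        (∑ u, ((φ.vertices L).count u : F) * φ.δ u r.1) * φ.η r.2 + φ.function L r := by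
  rw [foldl_readSymbol, CycleCheck]
  refine and_congr ?_ ?_
  · simp only
    omega
  · simp only [pairing, bispread_tensor, Finset.mul_sum]
    simp only [mul_left_comm]

/-- If a check of the vanishing of a low degree function succeeds for many coins, then the
function vanishes. -/
theorem eq_zero_of_card_lt {f : F × F → F} (hf : f ∈ lowDeg₂ F (n + n) (t + t))
    {T : Finset (F × F)} (hT : (n + n + (t + t)) * Fintype.card F < T.card)
    (h : ∀ r ∈ T, f r = 0) : f = 0 := by
  classical
  by_contra h0
  refine absurd ((Finset.card_le_card fun r hr => ?_).trans (card_zeros₂_le hf h0)) hT.not_ge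
  exact Finset.mem_filter.2 ⟨Finset.mem_univ _, h r hr⟩

variable {p : ℕ} [CharP F p] {σ : EdgeStream n} {M : ℤ}

/-- Passing at many points makes the checked equalities identities. The first forces each vertex to
be announced exactly once. The second makes each sum of multiplicities over backward edges zero in
`F`, hence zero as an integer below `p`. -/
theorem isTopologicalOrder_of_card_lt (hn : 0 < n) (hM : ∀ u v, 0 ≤ σ.multiplicity u v ∧
    σ.multiplicity u v ≤ M) (hnp : n < p) (hMp : n * M < p) (L : List φ.Symbol)
    {T : Finset (F × F)} (hT : (n + n + (t + t)) * Fintype.card F < T.card)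
    (h : ∀ r ∈ T, φ.OrderCheck r (φ.bispread (fun u v => (σ.multiplicity u v : F)) r)
      (List.foldl (φ.readSymbol r) helpInit L)) :
    σ.IsTopologicalOrder (φ.vertices L) := by
  simp_rw [orderCheck_iff] at h
  set l := φ.vertices L
  obtain ⟨r₀, hr₀⟩ := Finset.card_pos.1 (by omega : 0 < T.card)
  have hlen := (h r₀ hr₀).1
  -- The test concerns the second variable only; it is made a function of two variables by a
  -- constant factor.
  have hspread : ∀ b y, φ.spread (fun v => (l.count v : F)) y b =
      φ.spread (fun _ => 1) y b := by
    intro b y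
    have h1 := sub_mem (φ.spread_mem (fun v => (l.count v : F)) b) (φ.spread_mem (fun _ => 1) b)
    have h2 := lowDeg₂_mono (by omega : n ≤ n + n) (by omega : t ≤ t + t)
      (tensor_mem_lowDeg₂ (const_mem_lowDeg hn (1 : F)) h1)
    have h3 := eq_zero_of_card_lt h2 hT fun r hr => by
      simp [(h r hr).2.1 b]
    have h4 := congrFun h3 (0, y)
    simpa [sub_eq_zero] using h4
  -- The count is 1 modulo `p`, and it is at most n < p because the list has length at most n.
  have hcount : ∀ v, l.count v = 1 := by
    intro v
    have h1 := hspread (φ.cls v) (φ.μ (φ.col v))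
    rw [spread_node, spread_node] at h1
    have h2 : (((l.count v : ℤ) - 1 : ℤ) : F) = 0 := by push_cast; rw [h1, sub_self]
    have h3 := (CharP.intCast_eq_zero_iff F p _).1 h2
    have h4 : l.count v ≤ n := List.count_le_length.trans hlen
    obtain ⟨k, hk⟩ := h3
    have h6 : k = 0 := by
      by_contra hk0
      rcases lt_or_gt_of_ne hk0 with h | h <;> nlinarith
    rw [h6] at hk
    omega
  have hnodup : l.Nodup := List.nodup_iff_count_le_one.2 fun v => (hcount v).le
  have hmem : ∀ v, v ∈ l := fun v => List.count_pos_iff.1 (by rw [hcount]; norm_num)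
  have hpair : φ.pairing (fun u v => (σ.multiplicity u v : F))
      (fun u v => (prefixCount l u v : F)) - φ.function L = 0 := by
    refine eq_zero_of_card_lt (sub_mem (φ.pairing_mem _ _) (φ.function_mem L).1) hT fun r hr => ?_
    simp [(h r hr).2.2]
  rw [sub_eq_zero] at hpair
  refine ⟨hnodup, hmem, fun u v huv => ?_⟩
  have hsum := φ.sum_pairing_node (fun u v => (σ.multiplicity u v : F))
    (fun u v => (prefixCount l u v : F)) u
  rw [hpair, (φ.function_mem L).2] at hsum
  have hz : ((∑ w, σ.multiplicity u w * prefixCount l u w : ℤ) : F) = 0 := by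
    push_cast; exact hsum.symm
  have hterm : ∀ w, 0 ≤ σ.multiplicity u w * prefixCount l u w := fun w =>
    mul_nonneg (hM u w).1 (by positivity)
  have hle : ∑ w, σ.multiplicity u w * prefixCount l u w ≤ n * M := by
    calc ∑ w, σ.multiplicity u w * prefixCount l u w ≤ ∑ _w : Fin n, M := by
          refine Finset.sum_le_sum fun w _ => ?_
          rw [prefixCount_of_nodup hnodup (hmem u) (hmem w)]
          split_ifs
          · simpa using (hM u w).1.trans (hM u w).2
          · simpa using (hM u w).2
      _ = n * M := by simp
  have h0 := CharP.intCast_eq_zero_of_lt (Finset.sum_nonneg fun w _ => hterm w)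
    (hle.trans_lt hMp) hz
  have h1 := (Finset.sum_eq_zero_iff_of_nonneg fun w _ => hterm w).1 h0 v (Finset.mem_univ v)
  rw [prefixCount_of_nodup hnodup (hmem u) (hmem v)] at h1
  have huv' : 0 < σ.multiplicity u v := huv
  by_contra hlt
  rw [if_neg hlt] at h1
  simp at h1
  omega

/-- In an acyclic digraph the announced vertices have a sink `u`. Its row sum is zero whatever its
weight, but the identity demands the number of times `u` was announced, which lies between 1 and n <
p. -/
theorem not_isAcyclic_of_card_lt (hM : ∀ u v, 0 ≤ σ.multiplicity u v)
    (hnp : n < p) (L : List φ.Symbol) (hmode : φ.mode L = false)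
    {T : Finset (F × F)} (hT : (n + n + (t + t)) * Fintype.card F < T.card)
    (h : ∀ r ∈ T, φ.CycleCheck r (φ.bispread (fun u v => (σ.multiplicity u v : F)) r)
      (List.foldl (φ.readSymbol r) helpInit L)) :
    ¬ σ.IsAcyclic := by
  intro hac
  simp_rw [cycleCheck_iff] at h
  have hne := φ.vertices_ne_nil_of_mode hmode
  set l := φ.vertices L
  obtain ⟨r₀, hr₀⟩ := Finset.card_pos.1 (by omega : 0 < T.card)
  have hlen := (h r₀ hr₀).1
  have hpair : φ.pairing (fun u v => (σ.multiplicity u v : F))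
      (fun u v => φ.weight L u * (l.count v : F)) -
      ((fun r : F × F => (∑ u, (l.count u : F) * φ.δ u r.1) * φ.η r.2) + φ.function L) = 0 := by
    refine eq_zero_of_card_lt (sub_mem (φ.pairing_mem _ _) (add_mem ?_ (φ.function_mem L).1)) hT
      fun r hr => ?_
    · exact lowDeg₂_mono (by omega : n ≤ n + n) (by omega : t ≤ t + t)
        (tensor_mem_lowDeg₂ (φ.sum_δ_mem fun u => (l.count u : F)) φ.η_mem)
    · simp [(h r hr).2]
  rw [sub_eq_zero] at hpair
  obtain ⟨u, hu, hsink⟩ := hac.exists_sink (S := {v | v ∈ l}) (List.exists_mem_of_ne_nil l hne)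
  have hsum := φ.sum_pairing_node (fun u v => (σ.multiplicity u v : F))
    (fun u v => φ.weight L u * (l.count v : F)) u
  rw [hpair] at hsum
  simp only [Pi.add_apply, Finset.sum_add_distrib, (φ.function_mem L).2, sum_δ_node,
    ← Finset.mul_sum, φ.sum_η, mul_one, add_zero] at hsum
  have hzero : ∀ v, (σ.multiplicity u v : F) * (φ.weight L u * (l.count v : F)) = 0 := by
    intro v
    by_cases hv : v ∈ l
    · have : σ.multiplicity u v = 0 := le_antisymm (not_lt.1 (hsink v hv)) (hM u v)
      rw [this, Int.cast_zero, zero_mul]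
    · rw [List.count_eq_zero_of_not_mem hv, Nat.cast_zero, mul_zero, mul_zero]
  rw [Finset.sum_eq_zero fun v _ => hzero v] at hsum
  have h1 := CharP.intCast_eq_zero_of_lt (F := F) (p := p) (k := l.count u) (by positivity)
    (by exact_mod_cast (List.count_le_length.trans hlen).trans_lt hnp) (by exact_mod_cast hsum)
  have h2 := List.count_pos_iff.2 hu
  omega

/-- Every vanishing function is described by some coefficients. -/
theorem exists_coefficients {Q : F × F → F} (hQ : Q ∈ φ.vanishing) :
    ∃ c : Fin (Module.finrank F φ.vanishing) → F,
      ((List.finRange _).map fun k => c k • φ.vanishingBasis k).sum = Q := by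
  refine ⟨(Module.finBasis F φ.vanishing).repr ⟨Q, hQ⟩, ?_⟩
  have h := congrArg φ.vanishing.subtype ((Module.finBasis F φ.vanishing).sum_repr ⟨Q, hQ⟩)
  rw [map_sum] at h
  rw [← List.ofFn_eq_map, List.sum_ofFn]
  exact h

theorem exists_message_of_isTopologicalOrder (hM : ∀ u v, 0 ≤ σ.multiplicity u v)
    {l : List (Fin n)} (hl : σ.IsTopologicalOrder l) :
    ∃ L : List φ.Symbol, L.length ≤ n + Module.finrank F φ.vanishing ∧ φ.vertices L = l ∧
      φ.mode L = true ∧ ∀ r, φ.OrderCheck r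
        (φ.bispread (fun u v => (σ.multiplicity u v : F)) r)
        (List.foldl (φ.readSymbol r) helpInit L) := by
  have hQ : φ.pairing (fun u v => (σ.multiplicity u v : F)) (fun u v => (prefixCount l u v : F)) ∈
      φ.vanishing := by
    refine ⟨φ.pairing_mem _ _, fun u => ?_⟩
    rw [sum_pairing_node]
    refine Finset.sum_eq_zero fun v _ => ?_
    rw [prefixCount_of_nodup hl.1 (hl.2.1 u) (hl.2.1 v)]
    split_ifs with h
    · simp
    · have h1 : ¬ 0 < σ.multiplicity u v := fun h' => h (hl.2.2 u v h')
      rw [le_antisymm (not_lt.1 h1) (hM u v)]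
      simp
  obtain ⟨c, hc⟩ := φ.exists_coefficients hQ
  refine ⟨φ.message l 0 true c, ?_, φ.vertices_message _ _ _ _,
    φ.mode_message _ _ _ _ (Or.inr rfl), fun r => ?_⟩
  · rw [length_message, hl.length_eq]
  · rw [orderCheck_iff, vertices_message, function_message, hc]
    refine ⟨hl.length_eq.le, fun b => ?_, rfl⟩
    simp only [List.count_eq_one_of_mem hl.1 (hl.2.1 _), Nat.cast_one]

theorem exists_message_of_not_isAcyclic (hM : ∀ u v, 0 ≤ σ.multiplicity u v ∧
    σ.multiplicity u v ≤ M) (hMp : n * M < p) (hσ : ¬ σ.IsAcyclic) :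
    ∃ L : List φ.Symbol, L.length ≤ n + Module.finrank F φ.vanishing ∧
      φ.mode L = false ∧ ∀ r, φ.CycleCheck r
        (φ.bispread (fun u v => (σ.multiplicity u v : F)) r)
        (List.foldl (φ.readSymbol r) helpInit L) := by
  classical
  obtain ⟨S, hS, hE⟩ := EdgeStream.exists_forall_edge_of_not_isAcyclic hσ
  obtain ⟨l, hnodup, hmem⟩ : ∃ l : List (Fin n), l.Nodup ∧ ∀ v, v ∈ l ↔ v ∈ S :=
    ⟨S.toFinset.toList, Finset.nodup_toList _, fun v => by simp⟩
  have hcount : ∀ v, l.count v ≤ 1 := List.nodup_iff_count_le_one.1 hnodup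
  have hlen : l.length ≤ n := by simpa using hnodup.length_le_card
  obtain ⟨D, hD⟩ : ∃ D : Fin n → F, ∀ u,
      D u = ∑ v, (σ.multiplicity u v : F) * (l.count v : F) := ⟨_, fun _ => rfl⟩
  -- The out-degree into the set, with multiplicity, is positive and at most n · M < p, so it is
  -- invertible modulo `p`.
  have hD0 : ∀ u ∈ l, D u ≠ 0 := by
    intro u hu h0
    have hterm : ∀ v, 0 ≤ σ.multiplicity u v * l.count v := fun v =>
      mul_nonneg (hM u v).1 (by positivity)
    have hle : ∑ v, σ.multiplicity u v * l.count v ≤ n * M := by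
      calc ∑ v, σ.multiplicity u v * l.count v ≤ ∑ _v : Fin n, M := by
            refine Finset.sum_le_sum fun v _ => ?_
            have h1 : (l.count v : ℤ) ≤ 1 := by exact_mod_cast hcount v
            have h2 := (hM u v).1
            have h3 := (hM u v).2
            nlinarith
        _ = n * M := by simp
    rw [hD] at h0
    have h1 := CharP.intCast_eq_zero_of_lt (F := F) (Finset.sum_nonneg fun v _ => hterm v)
      (hle.trans_lt hMp) (by push_cast; exact h0)
    obtain ⟨v, hv, huv⟩ := hE u ((hmem u).1 hu)
    have h2 := (Finset.sum_eq_zero_iff_of_nonneg fun v _ => hterm v).1 h1 v (Finset.mem_univ v)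
    rw [List.count_eq_one_of_mem hnodup ((hmem v).2 hv), Nat.cast_one, mul_one] at h2
    exact (ne_of_gt huv) h2
  have hQ : φ.pairing (fun u v => (σ.multiplicity u v : F))
      (fun u v => ((l.count u : F) * (D u)⁻¹) * (l.count v : F)) -
      (fun r : F × F => (∑ u, (l.count u : F) * φ.δ u r.1) * φ.η r.2) ∈ φ.vanishing := by
    refine ⟨sub_mem (φ.pairing_mem _ _) (lowDeg₂_mono (by omega : n ≤ n + n)
      (by omega : t ≤ t + t) (tensor_mem_lowDeg₂ (φ.sum_δ_mem fun u => (l.count u : F)) φ.η_mem)),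
      fun u => ?_⟩
    simp only [Pi.sub_apply, Finset.sum_sub_distrib, sum_pairing_node, sum_δ_node,
      ← Finset.mul_sum, φ.sum_η, mul_one, mul_left_comm _ ((l.count u : F) * (D u)⁻¹), ← hD]
    by_cases hu : u ∈ l
    · rw [mul_assoc, inv_mul_cancel₀ (hD0 u hu), mul_one, sub_self]
    · rw [List.count_eq_zero_of_not_mem hu]
      simp
  obtain ⟨c, hc⟩ := φ.exists_coefficients hQ
  have hne : l ≠ [] := by
    obtain ⟨u, hu⟩ := hS
    exact List.ne_nil_of_mem ((hmem u).2 hu)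
  refine ⟨φ.message l (fun u => (D u)⁻¹) false c, ?_, φ.mode_message _ _ _ _ (Or.inl hne),
    fun r => ?_⟩
  · rw [length_message]
    omega
  · rw [cycleCheck_iff, vertices_message, function_message, hc]
    refine ⟨hlen, ?_⟩
    simp only [weight_message, Pi.sub_apply]
    ring

end Frame

/-! ### The scheme and its parameters -/

theorem List.foldl_prodMk {α β γ : Type*} (f : α → γ → α) (g : β → γ → β) (l : List γ) (a : α)
    (b : β) : List.foldl (fun q x => (f q.1 x, g q.2 x)) (a, b) l = (l.foldl f a, l.foldl g b) := by
  induction l generalizing a b with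
  | nil => rfl
  | cons x l ih => exact ih _ _

theorem Scheme.Solves.mono {n : ℕ} {Γ : Type} {S : Scheme n Γ} {P : StreamProblem n Γ} {h h' : ℕ}
    {εc εs : ℝ} (hS : S.Solves P h εc εs) (hh : h ≤ h') : S.Solves P h' εc εs :=
  ⟨fun σ hσ => (hS.1 σ hσ).imp fun _ hH => ⟨hH.1.trans hh, hH.2⟩, hS.2⟩

namespace Frame

variable {F : Type} [Field F] [Fintype F] {n s t : ℕ} (φ : Frame F n s t)

open scoped Classical in
/-- Verifier's decision: in the mode `true` he ends with `yes` if the order check succeeds, and in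
the mode `false` he ends with `no` if the cycle check succeeds. -/
noncomputable def decision {Γ : Type} (yes : List Γ) (no : Option (List Γ)) (r : F × F)
    (q : (Fin s → F) × HelpState F n s) : Option (List Γ) :=
  if q.2.mode = true then (if φ.OrderCheck r q.1 q.2 then some yes else none)
  else (if φ.CycleCheck r q.1 q.2 then no else none)

/-- Verifier's memory after the stream `σ` and the help message `L`. -/
theorem foldl_state (r : F × F) (σ : EdgeStream n) (L : List φ.Symbol) :
    List.foldl (fun q a => (q.1, φ.readSymbol r q.2 a))
      (List.foldl (fun (q : (Fin s → F) × HelpState F n s) τ => (φ.readSketch r q.1 τ, q.2))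
        (0, helpInit) σ) L =
      (φ.bispread (fun u v => (σ.multiplicity u v : F)) r,
        List.foldl (φ.readSymbol r) helpInit L) := by
  have h1 := List.foldl_prodMk (φ.readSketch r) (fun (h : HelpState F n s) _ => h) σ 0 helpInit
  have h2 := fun A => List.foldl_prodMk (fun (A : Fin s → F) (_ : φ.Symbol) => A) (φ.readSymbol r)
    L A helpInit
  have h3 : ∀ h : HelpState F n s, List.foldl (fun h (_ : EdgeUpdate n) => h) h σ = h := fun h => by simp
  have h4 : ∀ A : Fin s → F, List.foldl (fun A (_ : φ.Symbol) => A) A L = A := fun A => by simp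
  rw [h1, h3, h2, h4, foldl_readSketch]
  simp

variable {p : ℕ} [CharP F p] {Γ : Type}

/-- The scheme built from a frame. -/
theorem exists_scheme (P : StreamProblem n Γ) {M : ℕ} (wr : Fin n → List Γ) (yes : List Γ)
    (no : Option (List Γ))
    (hin : ∀ σ ∈ P.inputs, ∀ u v, 0 ≤ σ.multiplicity u v ∧ σ.multiplicity u v ≤ M)
    (hyes : ∀ σ ∈ P.inputs, ∀ l, σ.IsTopologicalOrder l → P.IsAnswer σ (l.flatMap wr ++ yes))
    (hno : ∀ σ ∈ P.inputs, ¬ σ.IsAcyclic → ∃ y, no = some y ∧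
      ∀ l : List (Fin n), P.IsAnswer σ (l.flatMap wr ++ y))
    (hn : 0 < n) (hnp : n < p) (hMp : n * M < p)
    (hF : 3 * (n + n + (t + t)) ≤ Fintype.card F)
    {e ℓ m : ℕ} (he : Fintype.card F ≤ 2 ^ e) (hℓ : 0 < ℓ)
    (hSym : n * (Fintype.card F * 2) + Module.finrank F φ.vanishing * Fintype.card F ≤ 2 ^ ℓ)
    (hm : n + Module.finrank F φ.vanishing ≤ m) :
    ∃ S : Scheme n Γ, S.SpaceAtMost (e * (3 * s + 3) + (Nat.log 2 n + 3) + ℓ) ∧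
      S.RandomnessAtMost (e * 2) ∧ S.Solves P (ℓ * m) 0 (1 / 3) := by
  classical
  have hne : Nonempty φ.Symbol := ⟨.inl (⟨0, hn⟩, 0, true)⟩
  have hM' : ∀ σ ∈ P.inputs, ∀ u v, 0 ≤ σ.multiplicity u v := fun σ hσ u v => (hin σ hσ u v).1
  have hMp' : (n : ℤ) * (M : ℤ) < p := by exact_mod_cast hMp
  have hwr : ∀ L : List φ.Symbol, L.flatMap (fun a => (φ.vertexOf a).flatMap wr) =
      (φ.vertices L).flatMap wr := fun L => by rw [vertices, List.flatMap_assoc]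
  refine exists_scheme_of_symbolVerifier (C := F × F) (Sym := φ.Symbol)
    (Q := (Fin s → F) × HelpState F n s) (fun _ => (0, helpInit))
    (fun r q τ => (φ.readSketch r q.1 τ, q.2)) (fun r q a => (q.1, φ.readSymbol r q.2 a))
    (fun a => (φ.vertexOf a).flatMap wr) (φ.decision yes no) P hℓ ?_ ?_ ?_ ?_ ?_
  · simpa using hSym
  · have h1 := HelpState.card_le (F := F) (n := n) (s := s)
    have h2 : n + 2 ≤ 2 ^ (Nat.log 2 n + 2) := by
      have := Nat.lt_pow_succ_log_self one_lt_two n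
      rw [pow_succ] at *
      have : 1 ≤ 2 ^ Nat.log 2 n := Nat.one_le_two_pow
      omega
    rw [Fintype.card_prod, Fintype.card_fun, Fintype.card_fin]
    calc Fintype.card F ^ s * Fintype.card (HelpState F n s)
        ≤ Fintype.card F ^ s * (Fintype.card F ^ (2 * s + 3) * ((n + 2) * 2)) :=
          Nat.mul_le_mul_left _ h1
      _ = Fintype.card F ^ (3 * s + 3) * ((n + 2) * 2) := by ring
      _ ≤ (2 ^ e) ^ (3 * s + 3) * (2 ^ (Nat.log 2 n + 2) * 2) :=
          Nat.mul_le_mul (Nat.pow_le_pow_left he _) (Nat.mul_le_mul_right _ h2)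
      _ = 2 ^ (e * (3 * s + 3) + (Nat.log 2 n + 3)) := by
          rw [← pow_mul, ← pow_succ, ← pow_add]
  · rw [Fintype.card_prod, pow_mul, sq]
    exact Nat.mul_le_mul he he
  · intro σ hσ
    simp_rw [foldl_state, hwr]
    by_cases hac : σ.IsAcyclic
    · obtain ⟨l, hl⟩ := hac.exists_isTopologicalOrder
      obtain ⟨L, hL, hvert, hmode, hcheck⟩ :=
        φ.exists_message_of_isTopologicalOrder (hM' σ hσ) hl
      refine ⟨L, hL.trans hm, fun r => ⟨yes, ?_, ?_⟩⟩
      · rw [decision, if_pos, if_pos (hcheck r)]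
        rw [foldl_readSymbol]
        exact hmode
      · rw [hvert]
        exact hyes σ hσ l hl
    · obtain ⟨y, hy, hans⟩ := hno σ hσ hac
      obtain ⟨L, hL, hmode, hcheck⟩ :=
        φ.exists_message_of_not_isAcyclic (hin σ hσ) hMp' hac
      refine ⟨L, hL.trans hm, fun r => ⟨y, ?_, hans _⟩⟩
      rw [decision, if_neg, if_pos (hcheck r), hy]
      rw [foldl_readSymbol]
      simp [hmode]
  · intro σ hσ L
    simp_rw [foldl_state, hwr]
    have hnat : ∀ T : Finset (F × F), T.card ≤ (n + n + (t + t)) * Fintype.card F →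
        (T.card : ℝ) ≤ 1 / 3 * Fintype.card (F × F) := by
      intro T hT
      have h1 : 3 * T.card ≤ Fintype.card (F × F) := by
        rw [Fintype.card_prod]
        calc 3 * T.card ≤ 3 * ((n + n + (t + t)) * Fintype.card F) := Nat.mul_le_mul_left _ hT
          _ = 3 * (n + n + (t + t)) * Fintype.card F := by ring
          _ ≤ _ := Nat.mul_le_mul_right _ hF
      have h2 : (3 : ℝ) * T.card ≤ Fintype.card (F × F) := by exact_mod_cast h1
      linarith
    -- The mode and the written sequence depend on the message alone. If the bad coins were too
    -- many, the check they all pass would prove the answer correct, contradicting any one of them.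
    refine hnat _ (not_lt.1 fun hT => ?_)
    have hmode : ∀ r, (List.foldl (φ.readSymbol r) helpInit L).mode = φ.mode L := fun r => by
      rw [foldl_readSymbol]
    obtain ⟨r₀, hr₀⟩ := Finset.card_pos.1 (Nat.zero_lt_of_lt hT)
    obtain ⟨y₀, hy₀, hans₀⟩ := (Finset.mem_filter.1 hr₀).2
    cases hb : φ.mode L with
    | true =>
      have hy₀' : yes = y₀ := by
        rw [decision, if_pos ((hmode r₀).trans hb)] at hy₀
        split_ifs at hy₀
        exact Option.some.inj hy₀
      refine hans₀ (hy₀' ▸ hyes σ hσ _ (φ.isTopologicalOrder_of_card_lt hn (hin σ hσ) hnp hMp' L hT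
        fun r hr => ?_))
      obtain ⟨y, hy, -⟩ := (Finset.mem_filter.1 hr).2
      rw [decision, if_pos ((hmode r).trans hb)] at hy
      by_contra hc
      rw [if_neg hc] at hy
      simp at hy
    | false =>
      have hm : ∀ r, ¬ (List.foldl (φ.readSymbol r) helpInit L).mode = true := fun r => by
        rw [hmode, hb]
        decide
      have hac := φ.not_isAcyclic_of_card_lt (hM' σ hσ) hnp L hb hT fun r hr => by
        obtain ⟨y, hy, -⟩ := (Finset.mem_filter.1 hr).2
        rw [decision, if_neg (hm r)] at hy
        by_contra hc
        rw [if_neg hc] at hy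
        simp at hy
      obtain ⟨y, hy, hans⟩ := hno σ hσ hac
      have hy₀' : y = y₀ := by
        rw [decision, if_neg (hm r₀)] at hy₀
        split_ifs at hy₀
        rw [hy] at hy₀
        exact Option.some.inj hy₀
      exact hans₀ (hy₀' ▸ hans _)

end Frame

theorem hasNTSSchemes_of_answers {Γ : ℕ → Type} (P : ∀ n, StreamProblem n (Γ n)) (K : ℕ)
    (wr : ∀ n, Fin n → List (Γ n)) (yes : ∀ n, List (Γ n)) (no : ∀ n, Option (List (Γ n)))
    (hin : ∀ n, ∀ σ ∈ (P n).inputs, σ ∈ EdgeStream.turnstile n K)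
    (hyes : ∀ n, ∀ σ ∈ (P n).inputs, ∀ l, σ.IsTopologicalOrder l →
      (P n).IsAnswer σ (l.flatMap (wr n) ++ yes n))
    (hno : ∀ n, ∀ σ ∈ (P n).inputs, ¬ σ.IsAcyclic → ∃ y, no n = some y ∧
      ∀ l : List (Fin n), (P n).IsAnswer σ (l.flatMap (wr n) ++ y)) :
    HasNTSSchemes P := by
  -- A field element takes (K+7)λ bits, where λ = `Nat.log 2 n + 1`, and memory holds 3s + 3 of them
  -- besides the counter, the mode and the block buffer; this gives 7K. The 60 is 12 · 5, from
  -- blocks of (K+12)λ bits and 5nt symbols.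
  refine ⟨7 * K + 60, 1, fun n t s hn hts => ?_⟩
  -- The prime must exceed n · n^K, for sums of multiplicities, and 12n, so that false identities
  -- pass with probability at most 1/3.
  obtain ⟨p, hp, hNp, hpN⟩ := Nat.exists_prime_lt_and_le_two_mul (12 * n ^ (K + 2)) (by positivity)
  have : Fact p.Prime := ⟨hp⟩
  obtain ⟨lam, hlam⟩ : ∃ lam, lam = Nat.log 2 n + 1 := ⟨_, rfl⟩
  have hnlam : n ≤ 2 ^ lam := by rw [hlam]; exact (Nat.lt_pow_succ_log_self one_lt_two n).le
  have hlam1 : 1 ≤ lam := by omega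
  have hpn : n ≤ n ^ (K + 2) := Nat.le_self_pow (by omega) n
  have hpe : p ≤ 2 ^ ((K + 7) * lam) := by
    calc p ≤ 24 * n ^ (K + 2) := by omega
      _ ≤ 2 ^ (5 * lam) * (2 ^ lam) ^ (K + 2) := by
          refine Nat.mul_le_mul ?_ (Nat.pow_le_pow_left hnlam _)
          calc 24 ≤ 2 ^ 5 := by norm_num
            _ ≤ 2 ^ (5 * lam) := Nat.pow_le_pow_right (by norm_num) (by omega)
      _ = 2 ^ ((K + 7) * lam) := by rw [← pow_mul, ← pow_add]; congr 1; ring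
  have ht : 0 < t := by
    rcases Nat.eq_zero_or_pos t with rfl | h
    · omega
    · exact h
  have hs : 0 < s := by
    rcases Nat.eq_zero_or_pos s with rfl | h
    · omega
    · exact h
  -- Since `p` is chosen independently of `t`, the number of columns is capped at n.
  obtain ⟨t', ht', ht'n, ht't, hts'⟩ : ∃ t', 0 < t' ∧ t' ≤ n ∧ t' ≤ t ∧ n ≤ t' * s := by
    rcases le_total t n with h | h
    · exact ⟨t, ht, h, le_rfl, hts⟩
    · exact ⟨n, hn, le_rfl, h, Nat.le_mul_of_pos_right n hs⟩
  have hcard : Fintype.card (ZMod p) = p := ZMod.card p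
  obtain ⟨φ⟩ := Frame.exists (F := ZMod p) (n := n) (s := s) ht' hts' (by omega) (by omega)
  -- With the n announcements, the honest message has at most n + 4nt' ≤ 5nt' symbols.
  have hd : Module.finrank (ZMod p) φ.vanishing ≤ (n + n) * (t' + t') :=
    finrank_le_of_le_lowDeg₂ (by omega) (by omega) fun Q hQ => hQ.1
  have hd' : (n + n) * (t' + t') = 4 * (n * t') := by ring
  have hnt : n ≤ n * t' := Nat.le_mul_of_pos_right n ht'
  have hnt' : n * t' ≤ n * n := Nat.mul_le_mul_left n ht'n
  have hnt'' : n * t' ≤ n * t := Nat.mul_le_mul_left n ht't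
  have hSym : n * (Fintype.card (ZMod p) * 2) +
      Module.finrank (ZMod p) φ.vanishing * Fintype.card (ZMod p) ≤ 2 ^ ((K + 12) * lam) := by
    rw [hcard]
    calc n * (p * 2) + Module.finrank (ZMod p) φ.vanishing * p
        = (2 * n + Module.finrank (ZMod p) φ.vanishing) * p := by ring
      _ ≤ (8 * (n * n)) * p := Nat.mul_le_mul_right _ (by omega)
      _ ≤ (2 ^ (3 * lam) * (2 ^ lam * 2 ^ lam)) * 2 ^ ((K + 7) * lam) := by
          refine Nat.mul_le_mul (Nat.mul_le_mul ?_ (Nat.mul_le_mul hnlam hnlam)) hpe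
          calc 8 = 2 ^ 3 := by norm_num
            _ ≤ 2 ^ (3 * lam) := Nat.pow_le_pow_right (by norm_num) (by omega)
      _ = 2 ^ ((K + 12) * lam) := by
          rw [← pow_add, ← pow_add, ← pow_add]; congr 1; ring
  obtain ⟨S, hspace, hrand, hsol⟩ := φ.exists_scheme (p := p) (P n) (M := n ^ K) (wr n) (yes n)
    (no n) (fun σ hσ u v => by exact_mod_cast hin n σ hσ u v) (hyes n) (hno n) hn (by omega)
    (by
      rw [← pow_succ']
      exact (Nat.pow_le_pow_right hn (by omega : K + 1 ≤ K + 2)).trans_lt (by omega))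
    (by omega) (hcard.trans_le hpe) (by positivity : 0 < (K + 12) * lam) hSym
    (m := 5 * (n * t')) (by omega)
  have hls : lam ≤ s * lam := Nat.le_mul_of_pos_left _ hs
  have hKls : K * lam ≤ K * (s * lam) := Nat.mul_le_mul_left K hls
  refine ⟨S, ?_, ?_, hsol.mono ?_⟩
  · refine le_trans hspace (Nat.pow_le_pow_right (by norm_num) ?_)
    rw [← hlam, pow_one, show Nat.log 2 n + 3 = lam + 2 by omega]
    have h1 : (K + 7) * lam * (3 * s + 3) =
        3 * (K * (s * lam)) + 3 * (K * lam) + 21 * (s * lam) + 21 * lam := by ring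
    have h2 : (7 * K + 60) * s * lam = 7 * (K * (s * lam)) + 60 * (s * lam) := by ring
    have h3 : (K + 12) * lam = K * lam + 12 * lam := by ring
    rw [h1, h2, h3]
    omega
  · refine le_trans hrand (Nat.pow_le_pow_right (by norm_num) ?_)
    rw [← hlam, pow_one]
    have h1 : (K + 7) * lam * 2 = 2 * (K * lam) + 14 * lam := by ring
    have h2 : (7 * K + 60) * s * lam = 7 * (K * (s * lam)) + 60 * (s * lam) := by ring
    rw [h1, h2]
    omega
  · rw [← hlam, pow_one]
    calc (K + 12) * lam * (5 * (n * t')) = (5 * K + 60) * (n * t') * lam := by ring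
      _ ≤ (7 * K + 60) * (n * t) * lam :=
          Nat.mul_le_mul_right _ (Nat.mul_le_mul (by omega) hnt'')

/-- The promise excludes cycles, so the cycle mode is disabled by letting it always reject. -/
theorem hasNTSSchemes_topoSort (K : ℕ) :
    HasNTSSchemes fun n => topoSort n (EdgeStream.turnstile n K) := by
  refine hasNTSSchemes_of_answers _ K (fun n u => [u]) (fun _ => []) (fun _ => none)
    (fun n σ hσ => hσ.1) (fun n σ _ l hl => ?_) (fun n σ hσ h => absurd hσ.2 h)
  simpa [topoSort] using hl

theorem hasNTSSchemes_acyclicity (K : ℕ) :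
    HasNTSSchemes fun n => acyclicity n (EdgeStream.turnstile n K) := by
  refine hasNTSSchemes_of_answers _ K (fun _ _ => []) (fun _ => [true]) (fun _ => some [false])
    (fun n σ hσ => hσ) (fun n σ _ l hl => Or.inl ⟨?_, hl.isAcyclic⟩)
    (fun n σ hσ h => ⟨[false], rfl, fun l => Or.inr ⟨?_, h⟩⟩)
  · simp
  · simp

theorem mainTheorem9 :
    (∀ K : ℕ, HasNTSSchemes fun n => topoSort n (EdgeStream.turnstile n K)) ∧
    (∀ K : ℕ, HasNTSSchemes fun n => acyclicity n (EdgeStream.turnstile n K)) ∧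
    (RequiresQuadraticProduct fun n => topoSort n (EdgeStream.simpleVanilla n)) ∧
    (RequiresQuadraticProduct fun n => acyclicity n (EdgeStream.simpleVanilla n)) :=
  ⟨hasNTSSchemes_topoSort, hasNTSSchemes_acyclicity, requiresQuadraticProduct_topoSort,
    requiresQuadraticProduct_acyclicity⟩
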